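/- Theorem 3.1 (Invariance of the modified potential wells). Let $N\ge 3$, $0\le\mu\le (N-2)^2/8$, $2^*=\frac{2N}{N-2}$, $\beta=\frac{N-2}{4}$ and $K(y)=e^{|y|^2/4}$ on $\mathbb{R}^N$. Let $L^2_K$ be the $L^2$ space with respect to $K(y)\,dy$, with inner product $(\cdot,\cdot)_K$ (the same symbol denotes $\int fg\,K\,dy$ and $\int F\cdot G\,K\,dy$ whenever these make sense), and let $X$ be the completion of $C_c^\infty(\mathbb{R}^N)$ in the norm $\|\nabla v\|_{K,2}=\big(\int_{\mathbb{R}^N}|\nabla v|^2K\,dy\big)^{1/2}$, regarded as a subspace of $L^2_K$. For $v\in X$ and $\delta\in\mathbb{R}$ put $$A(v)=\int_{\mathbb{R}^N}\Big(|\nabla v|^2-\mu\frac{|v|^2}{|y|^2}-\beta|v|^2\Big)K\,dy,\qquad B(v)=\int_{\mathbb{R}^N}|v|^{2^*}K\,dy,$$ $$E_K(v)=\tfrac12A(v)-\tfrac1{2^*}B(v),\qquad D_K(v)=A(v)-B(v),\qquad D_{K,\delta}(v)=\delta A(v)-B(v),$$ $$d=\inf\{E_K(v): v\in X\setminus\{0\},\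 D_K(v)=0\},\qquad d(\delta)=\inf\{E_K(v): v\in X,\ \|\nabla v\|_{K,2}\ne 0,\ D_{K,\delta}(v)=0\}$$ (infima in the extended reals), and $$W_\delta=\{v\in X: D_{K,\delta}(v)>0,\ E_K(v)<d(\delta)\}\cup\{0\},\qquad V_\delta=\{v\in X: D_{K,\delta}(v)<0,\ E_K(v)<d(\delta)\}.$$ For $v_0\in X$ and $0<S\le\infty$, a weak solution on $[0,S)$ of $$v_s-\Delta v-\tfrac12\,y\cdot\nabla v=\beta v+\frac{\mu v}{|y|^2}+|v|^{2^*-2}v,\qquad v(0)=v_0,$$ is a function $v\in C([0,S);X)$ with $v(0)=v_0$ such that, for every finite $0<T<S$, $v\in L^\infty(0,T;X)$, $v_s\in L^2(0,T;L^2_K)$ and $$\int_0^s\big[(v_\tau,w)_K+(\nabla v,\nabla w)_K\big]\,d\tau=\int_0^s\Big(|v|^{2^*-2}v+\mu\frac{v}{|y|^2}+\beta v,\ w\Big)_K d\tau\qquad\text{for all } w\in X,\ 0<s<T.$$ Let $v_0\in X$ with $E_K(v_0)=e$, where $0<e<d$, and let $\delta_1<\delta_2$ be the two roots of the equation $d(\delta)=e$.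 Then: (1) If $D_K(v_0)>0$, every weak solution $v$ on $[0,S)$ with $v(0)=v_0$, for every $0<S\le\infty$ (in particular for $S$ the maximal existence time of $v$), satisfies $v(s)\in W_\delta$ for all $\delta_1<\delta<\delta_2$ and $0\le s<S$. (2) If $D_K(v_0)<0$, every such weak solution satisfies $v(s)\in V_\delta$ for all $\delta_1<\delta<\delta_2$ and $0\le s<S$. -/

import Mathlib

open MeasureTheory Set

noncomputable section

namespace HardySobolev

/-- Euclidean space `ℝ^N`. -/
abbrev Space (N : ℕ) : Type := EuclideanSpace ℝ (Fin N)

/-- The weight `K(y) = exp (|y|² / 4)`. -/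
def weight (N : ℕ) (y : Space N) : ℝ := Real.exp (‖y‖ ^ 2 / 4)

/-- The measure `K(y) dy` on `ℝ^N`. -/
def weightedMeasure (N : ℕ) : Measure (Space N) :=
  (volume : Measure (Space N)).withDensity (fun y => ENNReal.ofReal (weight N y))

/-- The weighted space `L²_K(ℝ^N)` of real functions (modulo a.e. equality). -/
abbrev L2K (N : ℕ) : Type := Lp ℝ 2 (weightedMeasure N)

/-- The weighted space `L²_K(ℝ^N; ℝ^N)` of vector fields (modulo a.e. equality). -/
abbrev L2KVec (N : ℕ) : Type := Lp (Space N) 2 (weightedMeasure N)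

/-- The pairs `(φ, ∇φ)` with `φ ∈ C_c^∞(ℝ^N)`, as a subspace of `L²_K × L²_K`. -/
def gradGraph (N : ℕ) : Submodule ℝ (L2K N × L2KVec N) where
  carrier := {q | ∃ φ : Space N → ℝ,
    ContDiff ℝ ((⊤ : ℕ∞) : WithTop ℕ∞) φ ∧ HasCompactSupport φ ∧
    (q.1 : Space N → ℝ) =ᵐ[weightedMeasure N] φ ∧
    (q.2 : Space N → Space N) =ᵐ[weightedMeasure N] gradient φ}
  zero_mem' := by
    refine ⟨0, contDiff_const, HasCompactSupport.zero, Lp.coeFn_zero _ _ _, ?_⟩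
    have h : gradient (0 : Space N → ℝ) = 0 := by
      funext y
      exact gradient_const y (0 : ℝ)
    rw [h]
    exact Lp.coeFn_zero _ _ _
  add_mem' := by
    rintro a b ⟨φ, hφ, hφc, ha1, ha2⟩ ⟨ψ, hψ, hψc, hb1, hb2⟩
    refine ⟨φ + ψ, hφ.add hψ, hφc.add hψc, ?_, ?_⟩
    · exact (Lp.coeFn_add a.1 b.1).trans (ha1.add hb1)
    · have h : gradient (φ + ψ) = gradient φ + gradient ψ := by
        funext y
        have h1 : DifferentiableAt ℝ φ y := (hφ.differentiable (by simp)) y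
        have h2 : DifferentiableAt ℝ ψ y := (hψ.differentiable (by simp)) y
        simp [gradient, fderiv_add h1 h2]
      rw [h]
      exact (Lp.coeFn_add a.2 b.2).trans (ha2.add hb2)
  smul_mem' := by
    rintro c a ⟨φ, hφ, hφc, ha1, ha2⟩
    refine ⟨c • φ, contDiff_const.smul hφ, hφc.smul_left (f := fun _ => c), ?_, ?_⟩
    · exact (Lp.coeFn_smul c a.1).trans (ha1.const_smul c)
    · have h : gradient (c • φ) = c • gradient φ := by
        funext y
        have h1 : DifferentiableAt ℝ φ y := (hφ.differentiable (by simp)) y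
        simp [gradient, fderiv_const_smul h1 c]
      rw [h]
      exact (Lp.coeFn_smul c a.2).trans (ha2.const_smul c)

/-- The space `X`, the completion of `C_c^∞(ℝ^N)` with respect to the norm
`‖∇v‖_{K,2} = (∫ |∇v|² K dy)^{1/2}`, realised as the closure of the pairs `(φ, ∇φ)` in
`L²_K(ℝ^N) × L²_K(ℝ^N; ℝ^N)`. On the pairs `(φ, ∇φ)` one has
`(N / 2) ‖φ‖_{K,2}² ≤ ‖∇φ‖_{K,2}²`, so the graph norm is equivalent to `‖∇φ‖_{K,2}`.
An element carries a function (`X.fn`) and its weak gradient (`X.grad`). -/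
abbrev X (N : ℕ) : Type := ↥((gradGraph N).topologicalClosure)

/-- The function in `L²_K` underlying an element of `X`. -/
def X.fn {N : ℕ} (v : X N) : L2K N := v.1.1

/-- The weak gradient of an element of `X`; `‖v.grad‖` is the norm `‖∇v‖_{K,2}` of `X`. -/
def X.grad {N : ℕ} (v : X N) : L2KVec N := v.1.2

/-- The critical exponent `2^* = 2N / (N - 2) = p + 1`. -/
def critExp (N : ℕ) : ℝ := 2 * (N : ℝ) / ((N : ℝ) - 2)

/-- `β = (N - 2) / 4 = 1 / (p - 1)`. -/
def beta (N : ℕ) : ℝ := ((N : ℝ) - 2) / 4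

/-- `A(v) = ∫ (|∇v|² - μ |v|² / |y|² - β |v|²) K dy`. -/
def A {N : ℕ} (μ : ℝ) (v : X N) : ℝ :=
  ∫ y, (‖v.grad y‖ ^ 2 - μ * (|v.fn y| ^ 2 / ‖y‖ ^ 2) - beta N * |v.fn y| ^ 2)
    ∂(weightedMeasure N)

/-- `B(v) = ∫ |v|^{2^*} K dy`. -/
def B {N : ℕ} (v : X N) : ℝ :=
  ∫ y, |v.fn y| ^ critExp N ∂(weightedMeasure N)

/-- The energy `E_K(v) = A(v) / 2 - B(v) / 2^*`. -/
def E {N : ℕ} (μ : ℝ) (v : X N) : ℝ := A μ v / 2 - B v / critExp N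

/-- `D_K(v) = A(v) - B(v)`. -/
def D {N : ℕ} (μ : ℝ) (v : X N) : ℝ := A μ v - B v

/-- `D_{K,δ}(v) = δ A(v) - B(v)`. -/
def Dδ {N : ℕ} (μ δ : ℝ) (v : X N) : ℝ := δ * A μ v - B v

/-- The Nehari manifold. -/
def nehari (N : ℕ) (μ : ℝ) : Set (X N) := {v | D μ v = 0 ∧ v ≠ 0}

/-- The modified Nehari manifold `𝒩_δ`. -/
def nehariδ (N : ℕ) (μ δ : ℝ) : Set (X N) := {v | Dδ μ δ v = 0 ∧ ‖v.grad‖ ≠ 0}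

/-- The depth `d` of the potential well, the infimum of `E_K` on the Nehari manifold
(an extended real). -/
def depth (N : ℕ) (μ : ℝ) : EReal := ⨅ v ∈ nehari N μ, ((E μ v : ℝ) : EReal)

/-- `d(δ)`, the infimum of `E_K` on `𝒩_δ` (an extended real, so that an empty set gives `+∞`
and an unbounded one `-∞`). -/
def depthδ (N : ℕ) (μ δ : ℝ) : EReal := ⨅ v ∈ nehariδ N μ δ, ((E μ v : ℝ) : EReal)

/-- The modified potential well `W_δ`. -/
def W (N : ℕ) (μ δ : ℝ) : Set (X N) :=
  {v | 0 < Dδ μ δ v ∧ ((E μ v : ℝ) : EReal) < depthδ N μ δ} ∪ {0}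

/-- The set `V_δ` corresponding to the modified potential well. -/
def V (N : ℕ) (μ δ : ℝ) : Set (X N) :=
  {v | Dδ μ δ v < 0 ∧ ((E μ v : ℝ) : EReal) < depthδ N μ δ}

/-- `v` is a weak solution on `ℝ^N × (0, T)` of
`v_s - Δv - (1/2) y·∇v = β v + μ v / |y|² + |v|^{2^*-2} v` with `v(0) = v₀`:
`v ∈ L^∞(0, T; X)`, `v_s ∈ L²(0, T; L²_K)`, and the equation holds tested with every `w ∈ X`.
That `v` has the weak time derivative `v'` is expressed by `v(s) = v(0) + ∫_0^s v'` in `L²_K`,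
that is, `v` is the representative that is continuous into `L²_K`. -/
structure IsWeakSolution {N : ℕ} (μ : ℝ) (v₀ : X N) (v : ℝ → X N) (T : ℝ) : Prop where
  initial : v 0 = v₀
  memLp_top : MemLp (fun s => (v s).grad) ⊤ (volume.restrict (Ioo 0 T))
  exists_deriv : ∃ v' : ℝ → L2K N,
    MemLp v' 2 (volume.restrict (Ioo 0 T)) ∧
    (∀ s ∈ Ioo 0 T, (v s).fn = (v 0).fn + ∫ τ in (0 : ℝ)..s, v' τ) ∧
    ∀ w : X N, ∀ s ∈ Ioo 0 T,
      ∫ τ in (0 : ℝ)..s, (inner ℝ (v' τ) w.fn + inner ℝ (v τ).grad w.grad) =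
        ∫ τ in (0 : ℝ)..s, ∫ y,
          (|(v τ).fn y| ^ (critExp N - 2) * (v τ).fn y + μ * ((v τ).fn y / ‖y‖ ^ 2)
            + beta N * (v τ).fn y) * w.fn y ∂(weightedMeasure N)

/-- `v` is a weak solution that exists on `[0, S)`, `0 < S ≤ ∞`: it is a weak solution on
`ℝ^N × (0, T)` for all finite `0 < T < S`, and `v ∈ C([0, S); X)`, continuity being taken in the
norm `‖∇v‖_{K,2}` of `X`. -/
structure IsWeakSolutionUpTo {N : ℕ} (μ : ℝ) (v₀ : X N) (v : ℝ → X N) (S : EReal) : Prop where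
  weak : ∀ T : ℝ, 0 < T → (T : EReal) < S → IsWeakSolution μ v₀ v T
  continuousOn : ContinuousOn (fun s => (v s).grad) {s : ℝ | 0 ≤ s ∧ (s : EReal) < S}

end HardySobolev

end

/-! The energy cannot increase along a weak solution, so `E μ (v s) ≤ e`. For `δ₁ < δ < δ₂` one has
`e < d(δ)`, hence the trajectory can meet `D_{K,δ} = 0` only at the origin. Near the origin `D_{K,δ}
≥ 0`, because `A` is coercive and `B` is of higher order. So the condition `D_{K,δ}(v(t)) ≥ 0` is
locally constant in time (`Dδ_nonneg_iff_along`), and its initial value decides between `W_δ` and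
`V_δ`; the zero state is harmless because it belongs to `W_δ`.

Coercivity (`norm_sq_div_le_A`) and continuity of the functionals come from weighted Poincaré, Hardy
and Sobolev inequalities. They are proved for test functions by integrating the divergence of `φ² k
y` for suitable `k`, and pass to `X` by Fatou.

The energy inequality is the delicate point: `v_s` takes values only in `L²_K`, so it is not an
admissible test function. The equation is tested with differences `v(τ) - v(c)` instead. Near each
point `E` is semiconvex up to an error in the `L²_K` norm (`exists_local_semiconvexity`), which
bounds `E(v(τ)) - E(v(c))` by `-(v_τ, v(τ) - v(c))` plus a quadratic error; a minimum argument
(`le_of_local_dissipation`) turns this into monotonicity.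

For the wells, scaling along rays shows that `d(δ)` is proportional to `depthProfile`, whose
logarithm is strictly concave on `(0, 2^*/2)`. This gives `d(δ) > e` between the two roots and
places `1` between them (`lt_depthδ_of_mem_Ioo`, `one_mem_Ioo`). As `D_{K,δ}(v₀)` has no zero for
`δ` in that interval, its sign is that of `D_K(v₀)`. -/

noncomputable section

namespace HardySobolev

open scoped ENNReal NNReal Topology InnerProductSpace
open Filter

/-! ### Weighted integral inequalities for test functions -/

section Integral

variable {N : ℕ}

/-- The integrand is the divergence of `Ψ(y) y`; integrate by parts in each coordinate. -/
theorem integral_euler_eq_zero {Ψ : Space N → ℝ} (hΨ : ContDiff ℝ 1 Ψ) (hc : HasCompactSupport Ψ) :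
    ∫ y, (N * Ψ y + fderiv ℝ Ψ y y) = 0 := by
  have hcd : Continuous (fderiv ℝ Ψ) := hΨ.continuous_fderiv (by simp)
  have hd : Differentiable ℝ Ψ := hΨ.differentiable (by simp)
  have hcs : HasCompactSupport (fderiv ℝ Ψ) := hc.fderiv ℝ
  let e : Fin N → Space N := fun i => EuclideanSpace.single i 1
  have hint (i : Fin N) : Integrable (fun y : Space N => y i * fderiv ℝ Ψ y (e i)) := by
    apply Continuous.integrable_of_hasCompactSupport (by fun_prop)
    exact (hcs.comp_left (g := fun L : Space N →L[ℝ] ℝ => L (e i)) (by simp)).mul_left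
  have hintΨ : Integrable Ψ := hΨ.continuous.integrable_of_hasCompactSupport hc
  have key (i : Fin N) : ∫ y : Space N, y i * fderiv ℝ Ψ y (e i) = - ∫ y, Ψ y := by
    have hf (y : Space N) : HasFDerivAt (fun y : Space N => y i)
        (EuclideanSpace.proj i : Space N →L[ℝ] ℝ) y :=
      (EuclideanSpace.proj i : Space N →L[ℝ] ℝ).hasFDerivAt
    have h1 (y : Space N) : fderiv ℝ (fun y : Space N => y i) y (e i) = 1 := by
      rw [(hf y).fderiv]; simp [e]
    rw [integral_mul_fderiv_eq_neg_fderiv_mul_of_integrable (f := fun y : Space N => y i)]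
    · simp [h1]
    · simpa [h1] using hintΨ
    · exact hint i
    · apply Continuous.integrable_of_hasCompactSupport (by fun_prop)
      exact hc.mul_left
    · exact fun y _ => (hf y).differentiableAt
    · exact fun y _ => hd y
  have hsum (y : Space N) : fderiv ℝ Ψ y y = ∑ i, y i * fderiv ℝ Ψ y (e i) := by
    have hy : ∑ i, y i • e i = y := by
      ext j
      simp [e, Pi.single_apply]
    calc fderiv ℝ Ψ y y = fderiv ℝ Ψ y (∑ i, y i • e i) := by rw [hy]
      _ = _ := by simp
  simp_rw [hsum]
  rw [integral_add (hintΨ.const_mul _) (integrable_finsetSum _ fun i _ => hint i),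
    integral_finsetSum _ fun i _ => hint i, integral_const_mul]
  simp [key]

theorem contDiff_weight : ContDiff ℝ 1 (weight N) := by
  unfold weight
  exact ((contDiff_norm_sq ℝ).div_const 4).exp

@[fun_prop]
theorem continuous_weight : Continuous (weight N) := contDiff_weight.continuous

theorem weight_pos (y : Space N) : 0 < weight N y := Real.exp_pos _

instance : IsLocallyFiniteMeasure (weightedMeasure N) :=
  IsLocallyFiniteMeasure.withDensity_ofReal continuous_weight

theorem integral_weightedMeasure (f : Space N → ℝ) :
    ∫ y, f y ∂(weightedMeasure N) = ∫ y, weight N y * f y := by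
  rw [weightedMeasure, integral_withDensity_eq_integral_toReal_smul
    (by fun_prop) (by simp)]
  simp [ENNReal.toReal_ofReal (weight_pos _).le]

theorem fderiv_weight_self (y : Space N) :
    fderiv ℝ (weight N) y y = ‖y‖ ^ 2 / 2 * weight N y := by
  have h := (((hasStrictFDerivAt_norm_sq y).hasFDerivAt.mul_const (4 : ℝ)⁻¹).exp).fderiv
  have h2 : weight N = fun x : Space N => Real.exp (‖x‖ ^ 2 * (4 : ℝ)⁻¹) := by
    funext x; simp [weight, div_eq_mul_inv]
  rw [h2, h]
  simp
  ring

theorem fderiv_self_weight_div (ε : ℝ) (hε : 0 < ε) (y : Space N) :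
    fderiv ℝ (fun y => weight N y * (‖y‖ ^ 2 + ε)⁻¹) y y =
      (‖y‖ ^ 2 / 2 - 2 * ‖y‖ ^ 2 * (‖y‖ ^ 2 + ε)⁻¹) * (weight N y * (‖y‖ ^ 2 + ε)⁻¹) := by
  have hne : ‖y‖ ^ 2 + ε ≠ 0 := by positivity
  have h1 : HasFDerivAt (weight N) (fderiv ℝ (weight N) y) y :=
    (contDiff_weight.differentiable (by simp) y).hasFDerivAt
  have h2 := (hasDerivAt_inv hne).comp_hasFDerivAt y
    ((hasStrictFDerivAt_norm_sq y).hasFDerivAt.add_const ε)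
  have h3 := (h1.mul h2).fderiv
  have h4 : (fun y => weight N y * (‖y‖ ^ 2 + ε)⁻¹) =
    weight N * (Inv.inv ∘ fun y : Space N => ‖y‖ ^ 2 + ε) := by funext y; simp
  rw [h4, h3]
  simp [fderiv_weight_self]
  field_simp
  ring

theorem abs_fderiv_self_le (φ : Space N → ℝ) (y : Space N) :
    |fderiv ℝ φ y y| ≤ ‖gradient φ y‖ * ‖y‖ := by
  rw [← toDual_gradient, InnerProductSpace.toDual_apply_apply]
  exact abs_real_inner_le_norm _ _

theorem integral_sq_mul_eq_zero {φ k : Space N → ℝ} (hφ : ContDiff ℝ 1 φ) (hc : HasCompactSupport φ)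
    (hk : ContDiff ℝ 1 k) :
    ∫ y, (φ y ^ 2 * (N * k y + fderiv ℝ k y y) + 2 * φ y * fderiv ℝ φ y y * k y) = 0 := by
  have hΨ : ContDiff ℝ 1 (fun y => φ y ^ 2 * k y) := (hφ.pow 2).mul hk
  have hcΨ : HasCompactSupport (fun y => φ y ^ 2 * k y) :=
    (hc.comp_left (g := fun x : ℝ => x ^ 2) (by simp)).mul_right
  rw [← integral_euler_eq_zero hΨ hcΨ]
  congr 1
  ext y
  have h1 := (hφ.differentiable (by simp) y).hasFDerivAt
  have h2 := (hk.differentiable (by simp) y).hasFDerivAt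
  rw [show (fun y => φ y ^ 2 * k y) = (fun y => φ y ^ 2) * k from rfl, ((h1.pow 2).mul h2).fderiv]
  simp
  ring

section TestFunction

variable {φ : Space N → ℝ} (hφ : ContDiff ℝ 1 φ) (hc : HasCompactSupport φ)
include hφ

theorem continuous_gradient : Continuous (gradient φ) := by
  have : gradient φ = fun y => (InnerProductSpace.toDual ℝ (Space N)).symm (fderiv ℝ φ y) := rfl
  rw [this]
  have := hφ.continuous_fderiv (by simp)
  fun_prop

include hc

omit hφ in
theorem hasCompactSupport_gradient : HasCompactSupport (gradient φ) :=
  (hc.fderiv ℝ).comp_left (g := (InnerProductSpace.toDual ℝ (Space N)).symm) (map_zero _)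

theorem integrable_gradient_sq_mul_weight :
    Integrable (fun y => ‖gradient φ y‖ ^ 2 * weight N y) := by
  have := continuous_gradient hφ
  apply Continuous.integrable_of_hasCompactSupport (by fun_prop)
  exact ((hasCompactSupport_gradient hc).comp_left
    (g := fun x : Space N => ‖x‖ ^ 2) (by simp)).mul_right

theorem integrable_sq_mul {k : Space N → ℝ} (hk : Continuous k) :
    Integrable (fun y => φ y ^ 2 * k y) := by
  have := hφ.continuous
  apply Continuous.integrable_of_hasCompactSupport (by fun_prop)
  exact (hc.comp_left (g := fun x : ℝ => x ^ 2) (by simp)).mul_right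

/-- The right side of `h` is the divergence of `φ² k y` and integrates to zero, so each choice of
`k` turns a pointwise Young inequality into an integral one. -/
theorem integral_sq_le_of_pointwise {k G : Space N → ℝ} (hk : ContDiff ℝ 1 k) (hG : Continuous G)
    {α γ : ℝ}
    (h : ∀ y, α * (φ y ^ 2 * G y) - γ * (‖gradient φ y‖ ^ 2 * weight N y) ≤
      φ y ^ 2 * (N * k y + fderiv ℝ k y y) + 2 * φ y * fderiv ℝ φ y y * k y) :
    α * ∫ y, φ y ^ 2 * G y ≤ γ * ∫ y, ‖gradient φ y‖ ^ 2 * weight N y := by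
  have h1 := integrable_gradient_sq_mul_weight hφ hc
  have h2 := integrable_sq_mul hφ hc hG
  have hkc := hk.continuous
  have hkd := hk.continuous_fderiv (by simp)
  have hφd := hφ.continuous_fderiv (by simp)
  have h3 := integrable_sq_mul hφ hc (k := fun y => N * k y + fderiv ℝ k y y) (by fun_prop)
  have h4 : Integrable (fun y => 2 * φ y * fderiv ℝ φ y y * k y) := by
    have := hφ.continuous
    apply Continuous.integrable_of_hasCompactSupport (by fun_prop)
    exact ((hc.comp_left (g := fun x : ℝ => 2 * x) (by simp)).mul_right).mul_right
  have := integral_mono ((h2.const_mul α).sub (h1.const_mul γ)) (h3.add h4) h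
  simp only [Pi.add_apply, Pi.sub_apply] at this
  rw [integral_sq_mul_eq_zero hφ hc hk, integral_sub (h2.const_mul α) (h1.const_mul γ),
    integral_const_mul, integral_const_mul] at this
  linarith

/-- With `k = K`, Young's inequality on the cross term uses up exactly the term `|y|²/2` produced by
differentiating the weight. -/
theorem integral_sq_mul_weight_le :
    N * ∫ y, φ y ^ 2 * weight N y ≤ 2 * ∫ y, ‖gradient φ y‖ ^ 2 * weight N y := by
  apply integral_sq_le_of_pointwise hφ hc contDiff_weight continuous_weight
  intro y
  have h1 := abs_fderiv_self_le φ y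
  have hK := weight_pos y
  rw [fderiv_weight_self]
  set D := fderiv ℝ φ y y
  set g := ‖gradient φ y‖
  set r := ‖y‖
  have h2 : -(φ y ^ 2 * r ^ 2 / 2 + 2 * g ^ 2) ≤ 2 * φ y * D := by
    have h3 : |φ y * D| ≤ |φ y| * (g * r) := by rw [abs_mul]; gcongr
    nlinarith [sq_nonneg (|φ y| * r - 2 * g), neg_abs_le (φ y * D), sq_abs (φ y)]
  nlinarith [mul_le_mul_of_nonneg_right h2 hK.le]

/-- Here Young spends only half of the `|y|²/2` term and keeps the rest. The second moment is needed
to differentiate `φ e^{|y|²/8}`. -/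
theorem integral_norm_sq_mul_sq_mul_weight_le :
    ∫ y, φ y ^ 2 * (‖y‖ ^ 2 * weight N y) ≤ 16 * ∫ y, ‖gradient φ y‖ ^ 2 * weight N y := by
  suffices (1 / 4) * ∫ y, φ y ^ 2 * (‖y‖ ^ 2 * weight N y) ≤
    4 * ∫ y, ‖gradient φ y‖ ^ 2 * weight N y by linarith
  apply integral_sq_le_of_pointwise hφ hc contDiff_weight (by fun_prop)
  intro y
  have h1 := abs_fderiv_self_le φ y
  have hK := weight_pos y
  rw [fderiv_weight_self]
  set D := fderiv ℝ φ y y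
  set g := ‖gradient φ y‖
  set r := ‖y‖
  have h2 : -(φ y ^ 2 * r ^ 2 / 4 + 4 * g ^ 2) ≤ 2 * φ y * D := by
    have h3 : |φ y * D| ≤ |φ y| * (g * r) := by rw [abs_mul]; gcongr
    nlinarith [sq_nonneg (|φ y| * r - 4 * g), neg_abs_le (φ y * D), sq_abs (φ y)]
  have h4 : 0 ≤ φ y ^ 2 * (N * weight N y) := by positivity
  nlinarith [mul_le_mul_of_nonneg_right h2 hK.le]

/-- Hardy's inequality from `k = K / (|y|² + ε)`; the shift by `ε` keeps `k` smooth at the origin.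
-/
theorem integral_hardy_regularized (hN : 3 ≤ N) {ε : ℝ} (hε : 0 < ε) :
    ((N : ℝ) - 2) ^ 2 * ∫ y, φ y ^ 2 * (weight N y * (‖y‖ ^ 2 + ε)⁻¹) ≤
      4 * ∫ y, ‖gradient φ y‖ ^ 2 * weight N y := by
  have hN' : (3 : ℝ) ≤ N := by exact_mod_cast hN
  -- The divergence contributes at least `N - 2 = 2c`; Young with weight `c` spends half of it,
  -- leaving the constant `c²`.
  set c : ℝ := ((N : ℝ) - 2) / 2 with hc'
  have hcpos : 0 < c := by rw [hc']; linarith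
  suffices c * ∫ y, φ y ^ 2 * (weight N y * (‖y‖ ^ 2 + ε)⁻¹) ≤
      c⁻¹ * ∫ y, ‖gradient φ y‖ ^ 2 * weight N y by
    have h2 := mul_le_mul_of_nonneg_left this (by positivity : 0 ≤ 4 * c)
    rw [show (N : ℝ) - 2 = 2 * c by rw [hc']; ring]
    field_simp at h2 ⊢
    linarith
  have hne (y : Space N) : ‖y‖ ^ 2 + ε ≠ 0 := by positivity
  have hk : ContDiff ℝ 1 (fun y => weight N y * (‖y‖ ^ 2 + ε)⁻¹) :=
    contDiff_weight.mul (((contDiff_norm_sq ℝ).add contDiff_const).inv hne)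
  apply integral_sq_le_of_pointwise hφ hc hk hk.continuous
  intro y
  have h1 := abs_fderiv_self_le φ y
  have hK := weight_pos y
  rw [fderiv_self_weight_div ε hε]
  set D := fderiv ℝ φ y y
  set g := ‖gradient φ y‖
  set r := ‖y‖
  set p := (r ^ 2 + ε)⁻¹ with hp
  have hp0 : 0 < p := by positivity
  have hrp : r ^ 2 * p ≤ 1 := by
    rw [hp, ← div_eq_mul_inv, div_le_one (by positivity)]; linarith
  have h2 : -(c * (φ y ^ 2 * p) + c⁻¹ * g ^ 2) ≤ 2 * φ y * D * p := by
    have h3 : |φ y * D| ≤ |φ y| * (g * r) := by rw [abs_mul]; gcongr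
    have h4 : -(|φ y| * (g * r)) * p ≤ (φ y * D) * p :=
      mul_le_mul_of_nonneg_right (by linarith [neg_abs_le (φ y * D)]) hp0.le
    have h5 : 2 * (|φ y| * (g * r)) * p ≤ c * (φ y ^ 2 * p * (r ^ 2 * p)) + c⁻¹ * g ^ 2 := by
      have h6 : 0 ≤ c⁻¹ * (c * (|φ y| * r * p) - g) ^ 2 := by positivity
      have h7 : c⁻¹ * (c * (|φ y| * r * p) - g) ^ 2 =
        c * (|φ y| ^ 2 * p * (r ^ 2 * p)) + c⁻¹ * g ^ 2 - 2 * (|φ y| * (g * r)) * p := by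
        field_simp
        ring
      rw [sq_abs] at h7
      linarith
    have h8 : c * (φ y ^ 2 * p * (r ^ 2 * p)) ≤ c * (φ y ^ 2 * p * 1) := by gcongr
    linarith
  have h9 := mul_le_mul_of_nonneg_right h2 hK.le
  have h10 : φ y ^ 2 * (weight N y * p) * (2 * (r ^ 2 * p)) ≤
    φ y ^ 2 * (weight N y * p) * (2 * 1) := by gcongr
  have h11 : 0 ≤ φ y ^ 2 * (weight N y * p) * (r ^ 2 / 2) := by positivity
  rw [show (N : ℝ) = 2 * c + 2 by rw [hc']; ring]
  linarith

end TestFunction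

end Integral

/-! ### The same bounds in terms of `L^p` norms, and the Sobolev inequality -/

section Norm

variable {N : ℕ}

theorem eLpNorm_two_eq {F : Type*} [NormedAddCommGroup F] {f : Space N → F}
    (hf : MemLp f 2 (weightedMeasure N)) :
    eLpNorm f 2 (weightedMeasure N) = ENNReal.ofReal √(∫ y, ‖f y‖ ^ 2 * weight N y) := by
  rw [hf.eLpNorm_eq_integral_rpow_norm (by simp) (by simp)]
  simp only [ENNReal.toReal_ofNat, Real.rpow_ofNat, integral_weightedMeasure]
  rw [← one_div, ← Real.sqrt_eq_rpow]
  simp_rw [mul_comm]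

theorem eLpNorm_two_le_of_integral_le {F F' : Type*} [NormedAddCommGroup F] [NormedAddCommGroup F']
    {f : Space N → F} {g : Space N → F'}
    (hf : MemLp f 2 (weightedMeasure N)) (hg : MemLp g 2 (weightedMeasure N)) {c : ℝ} (hc : 0 ≤ c)
    (h : ∫ y, ‖f y‖ ^ 2 * weight N y ≤ c ^ 2 * ∫ y, ‖g y‖ ^ 2 * weight N y) :
    eLpNorm f 2 (weightedMeasure N) ≤ ENNReal.ofReal c * eLpNorm g 2 (weightedMeasure N) := by
  rw [eLpNorm_two_eq hf, eLpNorm_two_eq hg, ← ENNReal.ofReal_mul hc]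
  apply ENNReal.ofReal_le_ofReal
  calc _ ≤ √(c ^ 2 * ∫ y, ‖g y‖ ^ 2 * weight N y) := Real.sqrt_le_sqrt h
    _ = _ := by rw [Real.sqrt_mul (by positivity), Real.sqrt_sq hc]

section TestFunction

variable {φ : Space N → ℝ} (hφ : ContDiff ℝ 1 φ) (hc : HasCompactSupport φ)
include hφ hc

theorem memLp_gradient : MemLp (gradient φ) 2 (weightedMeasure N) :=
  (continuous_gradient hφ).memLp_of_hasCompactSupport (hasCompactSupport_gradient hc)

theorem eLpNorm_poincare (hN : 0 < N) :
    eLpNorm φ 2 (weightedMeasure N) ≤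
      ENNReal.ofReal √(2 / N) * eLpNorm (gradient φ) 2 (weightedMeasure N) := by
  apply eLpNorm_two_le_of_integral_le (hφ.continuous.memLp_of_hasCompactSupport hc)
    (memLp_gradient hφ hc) (by positivity)
  rw [Real.sq_sqrt (by positivity)]
  have h := integral_sq_mul_weight_le hφ hc
  have : (0 : ℝ) < N := by exact_mod_cast hN
  simp only [Real.norm_eq_abs, sq_abs]
  rw [div_mul_eq_mul_div, le_div_iff₀ this]
  linarith

theorem eLpNorm_hardy_regularized (hN : 3 ≤ N) {ε : ℝ} (hε : 0 < ε) :
    eLpNorm (fun y => φ y * (√(‖y‖ ^ 2 + ε))⁻¹) 2 (weightedMeasure N) ≤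
      ENNReal.ofReal (2 / (N - 2)) * eLpNorm (gradient φ) 2 (weightedMeasure N) := by
  have hN' : (3 : ℝ) ≤ N := by exact_mod_cast hN
  have hne (y : Space N) : √(‖y‖ ^ 2 + ε) ≠ 0 := by positivity
  have hcont : Continuous (fun y => φ y * (√(‖y‖ ^ 2 + ε))⁻¹) := by
    have := hφ.continuous
    fun_prop (disch := exact hne _)
  apply eLpNorm_two_le_of_integral_le (hcont.memLp_of_hasCompactSupport hc.mul_right)
    (memLp_gradient hφ hc) (div_nonneg (by norm_num) (by linarith))
  have h := integral_hardy_regularized hφ hc hN hε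
  have h2 : (0 : ℝ) < (N - 2) ^ 2 := by nlinarith
  have h3 (y : Space N) : ‖φ y * (√(‖y‖ ^ 2 + ε))⁻¹‖ ^ 2 * weight N y =
      φ y ^ 2 * (weight N y * (‖y‖ ^ 2 + ε)⁻¹) := by
    rw [Real.norm_eq_abs, sq_abs, mul_pow, inv_pow, Real.sq_sqrt (by positivity)]
    ring
  simp only [h3]
  rw [div_pow, div_mul_eq_mul_div, le_div_iff₀ h2]
  linarith

/-- The gradient is `e^{|y|²/8} (∇φ + φ y / 4)`; its squared norm costs `2` from `∇φ` and `16 / 8`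
from the second moment, in total `4 = 2²`. -/
theorem eLpNorm_fderiv_mul_exp_le :
    eLpNorm (fderiv ℝ (fun y => φ y * Real.exp (‖y‖ ^ 2 / 8))) 2 volume ≤
      ENNReal.ofReal 2 * eLpNorm (gradient φ) 2 (weightedMeasure N) := by
  have hw : ContDiff ℝ 1 (fun y : Space N => Real.exp (‖y‖ ^ 2 / 8)) :=
    ((contDiff_norm_sq ℝ).div_const 8).exp
  have hu : ContDiff ℝ 1 (fun y => φ y * Real.exp (‖y‖ ^ 2 / 8)) := hφ.mul hw
  have huc : HasCompactSupport (fun y => φ y * Real.exp (‖y‖ ^ 2 / 8)) := hc.mul_right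
  have hmem : MemLp (fderiv ℝ (fun y => φ y * Real.exp (‖y‖ ^ 2 / 8))) 2 volume :=
    (hu.continuous_fderiv (by simp)).memLp_of_hasCompactSupport (huc.fderiv ℝ)
  have hpt (y : Space N) : ‖fderiv ℝ (fun y => φ y * Real.exp (‖y‖ ^ 2 / 8)) y‖ ^ 2 ≤
      2 * (‖gradient φ y‖ ^ 2 * weight N y) + (1 / 8) * (φ y ^ 2 * (‖y‖ ^ 2 * weight N y)) := by
    have h1 := (hφ.differentiable (by simp) y).hasFDerivAt
    have h2 := ((hasStrictFDerivAt_norm_sq y).hasFDerivAt.mul_const (8 : ℝ)⁻¹).exp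
    have h4 : (fun y => φ y * Real.exp (‖y‖ ^ 2 / 8)) =
      φ * (fun y => Real.exp (‖y‖ ^ 2 * (8 : ℝ)⁻¹)) := by
      funext y; simp [div_eq_mul_inv]
    rw [h4, (h1.mul h2).fderiv]
    have hg : ‖fderiv ℝ φ y‖ = ‖gradient φ y‖ :=
      ((InnerProductSpace.toDual ℝ (Space N)).symm.norm_map _).symm
    have hexp : Real.exp (‖y‖ ^ 2 * (8 : ℝ)⁻¹) ^ 2 = weight N y := by
      rw [← Real.exp_nat_mul, weight]; congr 1; push_cast; ring
    set E := Real.exp (‖y‖ ^ 2 * (8 : ℝ)⁻¹)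
    have hE : 0 < E := Real.exp_pos _
    have hn : ‖φ y • E • (8 : ℝ)⁻¹ • (2 • innerSL ℝ y) + E • fderiv ℝ φ y‖ ≤
        E * (|φ y| * ‖y‖ / 4 + ‖gradient φ y‖) := by
      refine (norm_add_le _ _).trans ?_
      rw [show (2 • innerSL ℝ y) = (2 : ℝ) • innerSL ℝ y by rw [two_smul, two_smul]]
      rw [norm_smul, norm_smul, norm_smul, norm_smul, norm_smul, hg]
      simp [abs_of_pos hE]
      linarith
    calc _ ≤ (E * (|φ y| * ‖y‖ / 4 + ‖gradient φ y‖)) ^ 2 := by gcongr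
      _ = E ^ 2 * (|φ y| * ‖y‖ / 4 + ‖gradient φ y‖) ^ 2 := by ring
      _ ≤ E ^ 2 * (2 * ‖gradient φ y‖ ^ 2 + (1 / 8) * (|φ y| ^ 2 * ‖y‖ ^ 2)) := by
        gcongr
        nlinarith [sq_nonneg (|φ y| * ‖y‖ / 4 - ‖gradient φ y‖)]
      _ = _ := by rw [hexp, sq_abs]; ring
  have hint := integrable_gradient_sq_mul_weight hφ hc
  have hint2 := integrable_sq_mul hφ hc (k := fun y => ‖y‖ ^ 2 * weight N y) (by fun_prop)
  have hle : ∫ y, ‖fderiv ℝ (fun y => φ y * Real.exp (‖y‖ ^ 2 / 8)) y‖ ^ 2 ≤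
      4 * ∫ y, ‖gradient φ y‖ ^ 2 * weight N y := by
    calc _ ≤ ∫ y, (2 * (‖gradient φ y‖ ^ 2 * weight N y) +
          (1 / 8) * (φ y ^ 2 * (‖y‖ ^ 2 * weight N y))) := by
          apply integral_mono_of_nonneg (ae_of_all _ fun y => by positivity)
            ((hint.const_mul _).add (hint2.const_mul _)) (ae_of_all _ hpt)
      _ ≤ _ := by
          rw [integral_add (hint.const_mul _) (hint2.const_mul _), integral_const_mul,
            integral_const_mul]
          linarith [integral_norm_sq_mul_sq_mul_weight_le hφ hc]
  rw [eLpNorm_two_eq (memLp_gradient hφ hc), hmem.eLpNorm_eq_integral_rpow_norm (by simp) (by simp)]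
  simp only [ENNReal.toReal_ofNat, Real.rpow_ofNat]
  rw [← one_div, ← Real.sqrt_eq_rpow, ← ENNReal.ofReal_mul (by norm_num)]
  apply ENNReal.ofReal_le_ofReal
  calc _ ≤ √(4 * ∫ y, ‖gradient φ y‖ ^ 2 * weight N y) := Real.sqrt_le_sqrt hle
    _ = _ := by
      rw [Real.sqrt_mul (by norm_num), show (4 : ℝ) = 2 ^ 2 by norm_num,
        Real.sqrt_sq (by norm_num)]

end TestFunction

theorem two_lt_critExp (hN : 3 ≤ N) : 2 < critExp N := by
  have hN' : (3 : ℝ) ≤ N := by exact_mod_cast hN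
  rw [critExp, lt_div_iff₀ (by linarith)]
  linarith

/-- The critical exponent as an extended nonnegative real. -/
def critExpENN (N : ℕ) : ℝ≥0∞ := ENNReal.ofReal (critExp N)

theorem critExpENN_toReal (hN : 3 ≤ N) : (critExpENN N).toReal = critExp N :=
  ENNReal.toReal_ofReal (by linarith [two_lt_critExp hN])

theorem critExpENN_ne_zero (hN : 3 ≤ N) : critExpENN N ≠ 0 := by
  have := two_lt_critExp hN
  simp only [critExpENN, ne_eq, ENNReal.ofReal_eq_zero]
  linarith

theorem critExpENN_ne_top : critExpENN N ≠ ∞ := ENNReal.ofReal_ne_top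

theorem one_le_critExpENN (hN : 3 ≤ N) : 1 ≤ critExpENN N := by
  have := two_lt_critExp hN
  rw [critExpENN, ENNReal.one_le_ofReal]
  linarith

/-- Since `2^* ≥ 2`, the weight `e^{|y|²/4}` is at most `e^{2^* |y|²/8}`. -/
theorem eLpNorm_weightedMeasure_le (hN : 3 ≤ N) (φ : Space N → ℝ) :
    eLpNorm φ (critExpENN N) (weightedMeasure N) ≤
      eLpNorm (fun y => φ y * Real.exp (‖y‖ ^ 2 / 8)) (critExpENN N) volume := by
  have hq := two_lt_critExp hN
  rw [eLpNorm_eq_lintegral_rpow_enorm_toReal (critExpENN_ne_zero hN) critExpENN_ne_top,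
    eLpNorm_eq_lintegral_rpow_enorm_toReal (critExpENN_ne_zero hN) critExpENN_ne_top,
    critExpENN_toReal hN, weightedMeasure,
    lintegral_withDensity_eq_lintegral_mul_non_measurable _ (by fun_prop) (by simp)]
  gcongr with y
  simp only [Pi.mul_apply, enorm_mul]
  rw [ENNReal.mul_rpow_of_nonneg _ _ (by linarith), mul_comm]
  gcongr
  rw [Real.enorm_eq_ofReal (Real.exp_pos _).le, ENNReal.ofReal_rpow_of_pos (Real.exp_pos _),
    ← Real.exp_mul, weight]
  apply ENNReal.ofReal_le_ofReal
  apply Real.exp_le_exp.2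
  nlinarith [sq_nonneg ‖y‖]

/-- The unweighted Sobolev inequality applied to `φ e^{|y|²/8}`. -/
theorem exists_eLpNorm_sobolev (hN : 3 ≤ N) : ∃ C : ℝ≥0, ∀ φ : Space N → ℝ,
    ContDiff ℝ 1 φ → HasCompactSupport φ →
    eLpNorm φ (critExpENN N) (weightedMeasure N) ≤
      C * eLpNorm (gradient φ) 2 (weightedMeasure N) := by
  have hN' : (3 : ℝ) ≤ N := by exact_mod_cast hN
  refine ⟨SNormLESNormFDerivOfEqConst ℝ (volume : Measure (Space N)) ((2 : ℝ≥0) : ℝ) * 2,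
    fun φ hφ hc => ?_⟩
  have hu : ContDiff ℝ 1 (fun y => φ y * Real.exp (‖y‖ ^ 2 / 8)) :=
    hφ.mul ((contDiff_norm_sq ℝ).div_const 8).exp
  have huc : HasCompactSupport (fun y => φ y * Real.exp (‖y‖ ^ 2 / 8)) := hc.mul_right
  have h1 := eLpNorm_le_eLpNorm_fderiv_of_eq (volume : Measure (Space N)) hu huc
    (p := 2) (p' := (critExp N).toNNReal) (by norm_num) (by simp; omega) (by
      have := two_lt_critExp hN
      rw [Real.coe_toNNReal _ (by linarith)]
      simp [critExp]
      field_simp)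
  refine (eLpNorm_weightedMeasure_le hN φ).trans (h1.trans ?_)
  rw [ENNReal.coe_mul, mul_assoc]
  gcongr
  simpa using eLpNorm_fderiv_mul_exp_le hφ hc

end Norm

/-! ### Embeddings of `X`, coercivity and continuity of the functionals -/

section Energy

variable {N : ℕ}

/-- Fatou's lemma along an a.e. convergent subsequence of test functions. The factor `ρ` lets one
argument serve Poincaré, Hardy and Sobolev. -/
theorem eLpNorm_fn_mul_le {p C : ℝ≥0∞} (hC : C ≠ ∞) {ρ : Space N → ℝ} (hρ : Measurable ρ)
    (h : ∀ φ : Space N → ℝ, ContDiff ℝ 1 φ → HasCompactSupport φ →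
      eLpNorm (fun y => φ y * ρ y) p (weightedMeasure N) ≤
        C * eLpNorm (gradient φ) 2 (weightedMeasure N)) (v : X N) :
    eLpNorm (fun y => v.fn y * ρ y) p (weightedMeasure N) ≤ C * ‖v.grad‖ₑ := by
  obtain ⟨x, hx, hlim⟩ := mem_closure_iff_seq_limit.1 v.2
  have h1 : Tendsto (fun n => (x n).1) atTop (𝓝 v.fn) :=
    (continuous_fst.tendsto _).comp hlim
  have h2 : Tendsto (fun n => (x n).2) atTop (𝓝 v.grad) :=
    (continuous_snd.tendsto _).comp hlim
  obtain ⟨ns, hns, hae⟩ := (tendstoInMeasure_of_tendsto_Lp h1).exists_seq_tendsto_ae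
  have hbound (n : ℕ) : eLpNorm (fun y => (x (ns n)).1 y * ρ y) p (weightedMeasure N) ≤
      C * ‖(x (ns n)).2‖ₑ := by
    obtain ⟨φ, hφ, hc, e1, e2⟩ := hx (ns n)
    have e3 : (fun y => (x (ns n)).1 y * ρ y) =ᵐ[weightedMeasure N] fun y => φ y * ρ y :=
      e1.mul (EventuallyEq.refl _ ρ)
    rw [Lp.enorm_def, eLpNorm_congr_ae e2, eLpNorm_congr_ae e3]
    exact h φ (hφ.of_le (by exact_mod_cast le_top)) hc
  have h3 : Tendsto (fun n => C * ‖(x (ns n)).2‖ₑ) atTop (𝓝 (C * ‖v.grad‖ₑ)) :=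
    ENNReal.Tendsto.const_mul (h2.comp hns.tendsto_atTop).enorm (Or.inr hC)
  calc _ ≤ atTop.liminf fun n =>
        eLpNorm (fun y => (x (ns n)).1 y * ρ y) p (weightedMeasure N) := by
        apply Lp.eLpNorm_lim_le_liminf_eLpNorm
        · exact fun n => (Lp.aestronglyMeasurable _).mul hρ.aestronglyMeasurable
        · filter_upwards [hae] with y hy
          exact hy.mul_const _
    _ ≤ atTop.liminf fun n => C * ‖(x (ns n)).2‖ₑ :=
        liminf_le_liminf (Eventually.of_forall hbound)
    _ = _ := h3.liminf_eq

theorem enorm_fn_le (hN : 0 < N) (v : X N) : ‖v.fn‖ₑ ≤ ENNReal.ofReal √(2 / N) * ‖v.grad‖ₑ := by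
  rw [Lp.enorm_def]
  simpa using eLpNorm_fn_mul_le (p := 2) (ρ := 1) ENNReal.ofReal_ne_top measurable_one
    (fun φ hφ hc => by simpa using eLpNorm_poincare hφ hc hN) v

theorem norm_fn_sq_le (hN : 0 < N) (v : X N) : ‖v.fn‖ ^ 2 ≤ 2 / N * ‖v.grad‖ ^ 2 := by
  have h := enorm_fn_le hN v
  rw [← ofReal_norm, ← ofReal_norm, ← ENNReal.ofReal_mul (by positivity),
    ENNReal.ofReal_le_ofReal_iff (by positivity)] at h
  calc ‖v.fn‖ ^ 2 ≤ (√(2 / N) * ‖v.grad‖) ^ 2 := by gcongr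
    _ = _ := by rw [mul_pow, Real.sq_sqrt (by positivity)]

/-- The product norm is a maximum, and Poincaré with `2 / N ≤ 1` makes the gradient component the
larger one. -/
theorem norm_eq_norm_grad (hN : 3 ≤ N) (v : X N) : ‖v‖ = ‖v.grad‖ := by
  have h := norm_fn_sq_le (by omega) v
  have hN' : (3 : ℝ) ≤ N := by exact_mod_cast hN
  have h2 : (2 : ℝ) / N ≤ 1 := by rw [div_le_one (by linarith)]; linarith
  have h3 : ‖v.fn‖ ≤ ‖v.grad‖ := by
    apply le_of_sq_le_sq _ (norm_nonneg _)
    nlinarith [sq_nonneg ‖v.grad‖]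
  exact max_eq_right h3

/-- A second use of Fatou removes the regularization, the origin being a null set. -/
theorem eLpNorm_fn_div_norm_le (hN : 3 ≤ N) (v : X N) :
    eLpNorm (fun y => v.fn y * ‖y‖⁻¹) 2 (weightedMeasure N) ≤
      ENNReal.ofReal (2 / (N - 2)) * ‖v.grad‖ₑ := by
  have : Nonempty (Fin N) := ⟨⟨0, by omega⟩⟩
  have hz : ∀ᵐ y : Space N ∂(weightedMeasure N), y ≠ 0 := by
    have : weightedMeasure N {0} = 0 :=
      withDensity_absolutelyContinuous _ _ (measure_singleton 0)
    rw [ae_iff]; simpa using this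
  have hlim : Tendsto (fun n : ℕ => 1 / ((n : ℝ) + 1)) atTop (𝓝 0) :=
    tendsto_one_div_add_atTop_nhds_zero_nat
  have hbound (n : ℕ) : eLpNorm (fun y => v.fn y * (√(‖y‖ ^ 2 + 1 / ((n : ℝ) + 1)))⁻¹) 2
      (weightedMeasure N) ≤ ENNReal.ofReal (2 / (N - 2)) * ‖v.grad‖ₑ :=
    eLpNorm_fn_mul_le ENNReal.ofReal_ne_top (by fun_prop)
      (fun φ hφ hc => eLpNorm_hardy_regularized hφ hc hN (by positivity)) v
  apply Lp.eLpNorm_le_of_ae_tendsto (u := atTop) (Eventually.of_forall hbound)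
  · exact fun n => (Lp.aestronglyMeasurable _).mul
      (Measurable.aestronglyMeasurable (by fun_prop))
  · filter_upwards [hz] with y hy
    apply Tendsto.const_mul
    have hy' : 0 < ‖y‖ := norm_pos_iff.2 hy
    have h1 : Tendsto (fun n : ℕ => √(‖y‖ ^ 2 + 1 / ((n : ℝ) + 1))) atTop (𝓝 ‖y‖) := by
      have := (hlim.const_add (‖y‖ ^ 2)).sqrt
      rwa [add_zero, Real.sqrt_sq hy'.le] at this
    exact h1.inv₀ hy'.ne'

theorem memLp_fn_div_norm (hN : 3 ≤ N) (v : X N) :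
    MemLp (fun y => v.fn y * ‖y‖⁻¹) 2 (weightedMeasure N) :=
  ⟨(Lp.aestronglyMeasurable _).mul (Measurable.aestronglyMeasurable (by fun_prop)),
    (eLpNorm_fn_div_norm_le hN v).trans_lt (ENNReal.mul_lt_top (by simp) (by simp))⟩

theorem exists_eLpNorm_fn_le (hN : 3 ≤ N) : ∃ C : ℝ≥0, ∀ v : X N,
    eLpNorm v.fn (critExpENN N) (weightedMeasure N) ≤ C * ‖v.grad‖ₑ := by
  obtain ⟨C, hC⟩ := exists_eLpNorm_sobolev hN
  exact ⟨C, fun v => by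
    simpa using eLpNorm_fn_mul_le (ρ := 1) ENNReal.coe_ne_top measurable_one
      (fun φ hφ hc => by simpa using hC φ hφ hc) v⟩

theorem memLp_fn_crit (hN : 3 ≤ N) (v : X N) : MemLp v.fn (critExpENN N) (weightedMeasure N) := by
  obtain ⟨C, hC⟩ := exists_eLpNorm_fn_le hN
  exact ⟨Lp.aestronglyMeasurable _, (hC v).trans_lt (ENNReal.mul_lt_top (by simp) (by simp))⟩

/-- The function underlying an element of `X`, as a continuous linear map. -/
def fnL (N : ℕ) : X N →L[ℝ] L2K N :=
  (ContinuousLinearMap.fst ℝ (L2K N) (L2KVec N)).comp (Submodule.subtypeL _)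

/-- The weak gradient, as a continuous linear map. -/
def gradL (N : ℕ) : X N →L[ℝ] L2KVec N :=
  (ContinuousLinearMap.snd ℝ (L2K N) (L2KVec N)).comp (Submodule.subtypeL _)

theorem fnL_apply (v : X N) : fnL N v = v.fn := rfl
theorem gradL_apply (v : X N) : gradL N v = v.grad := rfl

variable [hN : Fact (3 ≤ N)]

instance : Fact (1 ≤ critExpENN N) := ⟨one_le_critExpENN hN.out⟩

/-- The map `v ↦ v / |y|` from `X` to `L²_K`. -/
def hardyL (N : ℕ) [hN : Fact (3 ≤ N)] : X N →L[ℝ] L2K N :=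
  LinearMap.mkContinuous
    { toFun := fun v => (memLp_fn_div_norm hN.out v).toLp
      map_add' := fun v w => by
        rw [← MemLp.toLp_add, MemLp.toLp_eq_toLp_iff]
        filter_upwards [Lp.coeFn_add v.fn w.fn] with y hy
        change (v.fn + w.fn : L2K N) y * _ = _
        rw [hy, Pi.add_apply, Pi.add_apply, add_mul]
      map_smul' := fun c v => by
        rw [RingHom.id_apply, ← MemLp.toLp_const_smul, MemLp.toLp_eq_toLp_iff]
        filter_upwards [Lp.coeFn_smul c v.fn] with y hy
        change (c • v.fn : L2K N) y * _ = _
        rw [hy, Pi.smul_apply, Pi.smul_apply, smul_mul_assoc] }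
    (2 / (N - 2)) (fun v => by
      have hN' : (3 : ℝ) ≤ N := by exact_mod_cast hN.out
      have h2 : (0 : ℝ) ≤ 2 / (N - 2) := div_nonneg (by norm_num) (by linarith)
      simp only [LinearMap.coe_mk, AddHom.coe_mk, Lp.norm_toLp]
      refine ENNReal.toReal_le_of_le_ofReal (by positivity) ?_
      rw [ENNReal.ofReal_mul h2, norm_eq_norm_grad hN.out, ofReal_norm]
      exact eLpNorm_fn_div_norm_le hN.out v)

theorem coeFn_hardyL (v : X N) :
    (hardyL N v : Space N → ℝ) =ᵐ[weightedMeasure N] fun y => v.fn y * ‖y‖⁻¹ :=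
  MemLp.coeFn_toLp (memLp_fn_div_norm hN.out v)

theorem norm_hardyL_le (v : X N) : ‖hardyL N v‖ ≤ 2 / (N - 2) * ‖v‖ := by
  have hN' : (3 : ℝ) ≤ N := by exact_mod_cast hN.out
  refine (hardyL N).le_of_opNorm_le (LinearMap.mkContinuous_norm_le _ ?_ _) v
  exact div_nonneg (by norm_num) (by linarith)

/-- The embedding of `X` into `L^{2^*}_K`. -/
def critL (N : ℕ) [hN : Fact (3 ≤ N)] : X N →L[ℝ] Lp ℝ (critExpENN N) (weightedMeasure N) :=
  LinearMap.mkContinuous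
    { toFun := fun v => (memLp_fn_crit hN.out v).toLp
      map_add' := fun v w => by
        rw [← MemLp.toLp_add, MemLp.toLp_eq_toLp_iff]
        exact Lp.coeFn_add v.fn w.fn
      map_smul' := fun c v => by
        rw [RingHom.id_apply, ← MemLp.toLp_const_smul, MemLp.toLp_eq_toLp_iff]
        exact Lp.coeFn_smul c v.fn }
    (exists_eLpNorm_fn_le hN.out).choose (fun v => by
      simp only [LinearMap.coe_mk, AddHom.coe_mk, Lp.norm_toLp]
      refine ENNReal.toReal_le_of_le_ofReal (by positivity) ?_
      rw [ENNReal.ofReal_mul (by positivity), norm_eq_norm_grad hN.out, ofReal_norm,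
        ENNReal.ofReal_coe_nnreal]
      exact (exists_eLpNorm_fn_le hN.out).choose_spec v)

theorem coeFn_critL (v : X N) : (critL N v : Space N → ℝ) =ᵐ[weightedMeasure N] v.fn :=
  MemLp.coeFn_toLp (memLp_fn_crit hN.out v)

/-- The symmetric bilinear form associated with the quadratic form `A`. -/
def bilin (μ : ℝ) (v w : X N) : ℝ :=
  ⟪v.grad, w.grad⟫_ℝ - μ * ⟪hardyL N v, hardyL N w⟫_ℝ - beta N * ⟪v.fn, w.fn⟫_ℝ

omit hN in
theorem integrable_norm_sq {F : Type*} [NormedAddCommGroup F] [InnerProductSpace ℝ F]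
    (f : Lp F 2 (weightedMeasure N)) :
    Integrable (fun y => ‖f y‖ ^ 2) (weightedMeasure N) := by
  simpa using (Lp.memLp f).integrable_norm_pow (by simp)

omit hN in
theorem norm_sq_eq_integral {F : Type*} [NormedAddCommGroup F] [InnerProductSpace ℝ F]
    (f : Lp F 2 (weightedMeasure N)) :
    ‖f‖ ^ 2 = ∫ y, ‖f y‖ ^ 2 ∂(weightedMeasure N) := by
  rw [← real_inner_self_eq_norm_sq, L2.inner_def]
  simp

theorem A_eq (μ : ℝ) (v : X N) :
    A μ v = ‖v.grad‖ ^ 2 - μ * ‖hardyL N v‖ ^ 2 - beta N * ‖v.fn‖ ^ 2 := by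
  rw [norm_sq_eq_integral, norm_sq_eq_integral, norm_sq_eq_integral, A, ← integral_const_mul,
    ← integral_const_mul, ← integral_sub, ← integral_sub]
  · apply integral_congr_ae
    filter_upwards [coeFn_hardyL v] with y hy
    rw [hy]
    simp [div_eq_mul_inv, mul_pow]
  · exact (integrable_norm_sq _).sub ((integrable_norm_sq _).const_mul _)
  · exact (integrable_norm_sq _).const_mul _
  · exact integrable_norm_sq _
  · exact (integrable_norm_sq _).const_mul _

theorem A_sub (μ : ℝ) (x z : X N) : A μ x = A μ z + 2 * bilin μ z (x - z) + A μ (x - z) := by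
  have h : x = z + (x - z) := by abel
  generalize x - z = w at h
  subst h
  simp only [A_eq, bilin, ← fnL_apply, ← gradL_apply, map_add, norm_add_sq_real]
  ring

theorem A_smul (μ t : ℝ) (v : X N) : A μ (t • v) = t ^ 2 * A μ v := by
  simp only [A_eq, ← fnL_apply, ← gradL_apply, map_smul, norm_smul, mul_pow, Real.norm_eq_abs,
    sq_abs]
  ring

theorem continuous_A (μ : ℝ) : Continuous (A μ : X N → ℝ) := by
  have h1 : Continuous (fun v : X N => v.grad) := (gradL N).continuous
  have h2 : Continuous (fun v : X N => v.fn) := (fnL N).continuous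
  have : (A μ : X N → ℝ) = _ := funext (A_eq μ)
  rw [this]
  fun_prop

/-- Hardy bounds the singular term by `1/2` of `‖v‖²`, Poincaré bounds the `β` term by `β · 2/N =
1/2 - 1/N`; what remains is `1/N`. -/
theorem norm_sq_div_le_A {μ : ℝ} (hμ : μ ≤ ((N : ℝ) - 2) ^ 2 / 8) (v : X N) :
    ‖v‖ ^ 2 / N ≤ A μ v := by
  have hN' : (3 : ℝ) ≤ N := by exact_mod_cast hN.out
  have h1 : μ * ‖hardyL N v‖ ^ 2 ≤ ‖v‖ ^ 2 / 2 := by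
    calc μ * ‖hardyL N v‖ ^ 2 ≤ ((N : ℝ) - 2) ^ 2 / 8 * (2 / (N - 2) * ‖v‖) ^ 2 := by
          gcongr
          exact norm_hardyL_le v
      _ = ‖v‖ ^ 2 / 2 := by
          have : (N : ℝ) - 2 ≠ 0 := by linarith
          field_simp
          norm_num
  have h2 := norm_fn_sq_le (by have := hN.out; omega) v
  rw [← norm_eq_norm_grad hN.out] at h2
  have h3 : beta N * ‖v.fn‖ ^ 2 ≤ beta N * (2 / N * ‖v‖ ^ 2) := by
    gcongr
    rw [beta]; linarith
  have h4 : beta N * (2 / N * ‖v‖ ^ 2) = ‖v‖ ^ 2 / 2 - ‖v‖ ^ 2 / N := by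
    rw [beta]; field_simp; ring
  rw [A_eq, ← norm_eq_norm_grad hN.out]
  linarith

theorem B_eq (v : X N) : B v = ‖critL N v‖ ^ critExp N := by
  have hq := two_lt_critExp hN.out
  rw [Lp.norm_def, MemLp.eLpNorm_eq_integral_rpow_norm (critExpENN_ne_zero hN.out)
    critExpENN_ne_top (Lp.memLp _), critExpENN_toReal hN.out, ENNReal.toReal_ofReal (by positivity),
    ← Real.rpow_mul (by positivity), inv_mul_cancel₀ (by linarith), Real.rpow_one, B]
  apply integral_congr_ae
  filter_upwards [coeFn_critL v] with y hy
  rw [hy, Real.norm_eq_abs]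

theorem continuous_B : Continuous (B : X N → ℝ) := by
  have hq := two_lt_critExp hN.out
  have : (B : X N → ℝ) = _ := funext B_eq
  rw [this]
  exact ((critL N).continuous.norm).rpow_const fun _ => Or.inr (by linarith)

theorem B_smul {t : ℝ} (ht : 0 ≤ t) (v : X N) : B (t • v) = t ^ critExp N * B v := by
  rw [B_eq, B_eq, map_smul, norm_smul, Real.norm_eq_abs, abs_of_nonneg ht,
    Real.mul_rpow ht (norm_nonneg _)]

theorem B_nonneg (v : X N) : 0 ≤ B v := by rw [B_eq]; positivity

theorem B_le (v : X N) : B v ≤ ‖critL N‖ ^ critExp N * ‖v‖ ^ critExp N := by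
  have hq := two_lt_critExp hN.out
  rw [B_eq, ← Real.mul_rpow (by positivity) (by positivity)]
  gcongr
  exact (critL N).le_opNorm v

end Energy

/-! ### Elementary power inequalities and a three-factor Hölder inequality -/

section Hoelder

theorem add_one_mul_rpow_mul_le {a b r : ℝ} (ha : 0 ≤ a) (hb : 0 ≤ b) (hr : 0 < r) :
    (r + 1) * (a ^ r * b) ≤ b ^ (r + 1) + r * a ^ (r + 1) := by
  have hconj : ((r + 1) / r).HolderConjugate (r + 1) := by
    rw [Real.holderConjugate_iff]
    constructor
    · rw [lt_div_iff₀ hr]; linarith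
    · field_simp
  have h := Real.young_inequality_of_nonneg (Real.rpow_nonneg ha r) hb hconj
  rw [← Real.rpow_mul ha, mul_div_cancel₀ _ hr.ne'] at h
  calc (r + 1) * (a ^ r * b) ≤ (r + 1) * (a ^ (r + 1) / ((r + 1) / r) + b ^ (r + 1) / (r + 1)) := by
        gcongr
    _ = _ := by field_simp; ring

theorem abs_rpow_mul_self_sub_le {r : ℝ} (hr : 0 < r) (x z : ℝ) :
    |(|x| ^ r * x) - |z| ^ r * z| ≤ (1 + r) * (|x| ^ r + |z| ^ r) * |x - z| := by
  wlog h : |z| ≤ |x| generalizing x z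
  · have := this z x (le_of_not_ge h)
    rwa [abs_sub_comm, abs_sub_comm z x, add_comm (|z| ^ r)] at this
  have hrx : |z| ^ r ≤ |x| ^ r := by gcongr
  have h1 : (|x| ^ r - |z| ^ r) * |z| ≤ r * (|x| ^ r * |x - z|) := by
    have h2 := add_one_mul_rpow_mul_le (abs_nonneg x) (abs_nonneg z) hr
    rw [Real.rpow_add_one' (abs_nonneg _) (by linarith),
      Real.rpow_add_one' (abs_nonneg _) (by linarith)] at h2
    have h3 : |x| ^ r * (|x| - |z|) ≤ |x| ^ r * |x - z| := by
      gcongr; exact abs_sub_abs_le_abs_sub x z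
    nlinarith [mul_le_mul_of_nonneg_left h3 hr.le]
  calc |(|x| ^ r * x) - |z| ^ r * z| = |(|x| ^ r * (x - z)) + (|x| ^ r - |z| ^ r) * z| := by
        congr 1; ring
    _ ≤ |x| ^ r * |x - z| + (|x| ^ r - |z| ^ r) * |z| := by
        refine (abs_add_le _ _).trans (le_of_eq ?_)
        rw [abs_mul, abs_mul, abs_of_nonneg (Real.rpow_nonneg (abs_nonneg x) r),
          abs_of_nonneg (sub_nonneg.2 hrx)]
    _ ≤ (1 + r) * (|x| ^ r * |x - z|) := by linarith
    _ ≤ (1 + r) * ((|x| ^ r + |z| ^ r) * |x - z|) := by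
        gcongr
        linarith [Real.rpow_nonneg (abs_nonneg z) r]
    _ = _ := by ring

theorem abs_rpow_div_sub_le {r : ℝ} (hr : 0 < r) (x z : ℝ) :
    |x| ^ (r + 2) / (r + 2) - |z| ^ (r + 2) / (r + 2) ≤ |x| ^ r * x * (x - z) := by
  have h := add_one_mul_rpow_mul_le (abs_nonneg x) (abs_nonneg z) (by linarith : 0 < r + 1)
  rw [show r + 1 + 1 = r + 2 by ring] at h
  have h1 : |x| ^ (r + 2) = |x| ^ r * (x * x) := by
    rw [Real.rpow_add' (abs_nonneg _) (by linarith), Real.rpow_two, sq_abs, sq]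
  have h2 : |x| ^ (r + 1) * |z| ≥ |x| ^ r * (x * z) := by
    rw [Real.rpow_add_one' (abs_nonneg _) (by linarith), mul_assoc, ← abs_mul]
    gcongr
    exact le_abs_self _
  rw [← sub_div, div_le_iff₀ (by linarith)]
  have h3 : (r + 2) * (|x| ^ r * (x * z)) ≤ (r + 2) * (|x| ^ (r + 1) * |z|) := by gcongr
  have h4 : |x| ^ r * x * (x - z) * (r + 2) = (r + 2) * |x| ^ (r + 2) -
    (r + 2) * (|x| ^ r * (x * z)) := by rw [h1]; ring
  linarith

/-- By convexity the first-order remainder of `|·|^{r+2}/(r+2)` is at most the increment of the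
derivative times `x - z`. -/
theorem remainder_le {r : ℝ} (hr : 0 < r) (x z : ℝ) :
    |x| ^ (r + 2) / (r + 2) - |z| ^ (r + 2) / (r + 2) - |z| ^ r * z * (x - z) ≤
      (1 + r) * (|x| ^ r * |x - z| * |x - z| + |z| ^ r * |x - z| * |x - z|) := by
  have h1 := abs_rpow_div_sub_le hr x z
  have h2 := abs_rpow_mul_self_sub_le hr x z
  have h3 : (|x| ^ r * x - |z| ^ r * z) * (x - z) ≤
      (1 + r) * (|x| ^ r + |z| ^ r) * |x - z| * |x - z| := by
    refine (le_abs_self _).trans ?_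
    rw [abs_mul]
    gcongr
  linarith

theorem abs_rpow_le_two_rpow_mul {r : ℝ} (hr : 0 < r) (x z : ℝ) :
    |x| ^ r ≤ 2 ^ r * (|x - z| ^ r + |z| ^ r) := by
  have h : |x| ≤ 2 * max |x - z| |z| := by
    have := abs_add_le (x - z) z
    rw [sub_add_cancel] at this
    linarith [le_max_left |x - z| |z|, le_max_right |x - z| |z|]
  calc |x| ^ r ≤ (2 * max |x - z| |z|) ^ r := by gcongr
    _ = 2 ^ r * (max |x - z| |z|) ^ r := Real.mul_rpow (by norm_num) (by positivity)
    _ ≤ _ := by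
      gcongr
      rcases le_total |x - z| |z| with h | h
      · rw [max_eq_right h]; linarith [Real.rpow_nonneg (abs_nonneg (x - z)) r]
      · rw [max_eq_left h]; linarith [Real.rpow_nonneg (abs_nonneg z) r]

theorem rpow_mul_mul_le_weighted {r a b c : ℝ} (hr : 0 < r) (ha : 0 ≤ a) (hb : 0 ≤ b)
    (hc : 0 ≤ c) :
    a ^ r * b * c ≤ (r * a ^ (r + 2) + b ^ (r + 2) + c ^ (r + 2)) / (r + 2) := by
  have h := Real.geom_mean_le_arith_mean3_weighted (w₁ := r / (r + 2)) (w₂ := 1 / (r + 2))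
    (w₃ := 1 / (r + 2)) (p₁ := a ^ (r + 2)) (p₂ := b ^ (r + 2)) (p₃ := c ^ (r + 2))
    (by positivity) (by positivity) (by positivity) (by positivity) (by positivity) (by positivity)
    (by field_simp; ring)
  rw [← Real.rpow_mul ha, ← Real.rpow_mul hb, ← Real.rpow_mul hc,
    mul_div_cancel₀ _ (by positivity), mul_div_cancel₀ _ (by positivity), Real.rpow_one,
    Real.rpow_one] at h
  refine h.trans (le_of_eq ?_)
  ring

variable {N : ℕ} [hN : Fact (3 ≤ N)]

/-- The space `L^{2^*}_K`. -/
abbrev LCrit (N : ℕ) : Type := Lp ℝ (critExpENN N) (weightedMeasure N)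

theorem integrable_abs_rpow (a : LCrit N) :
    Integrable (fun y => |a y| ^ critExp N) (weightedMeasure N) := by
  have := (Lp.memLp a).integrable_norm_rpow (critExpENN_ne_zero hN.out) critExpENN_ne_top
  rwa [critExpENN_toReal hN.out] at this

theorem integral_abs_rpow (a : LCrit N) :
    ∫ y, |a y| ^ critExp N ∂(weightedMeasure N) = ‖a‖ ^ critExp N := by
  have hq := two_lt_critExp hN.out
  rw [Lp.norm_def, MemLp.eLpNorm_eq_integral_rpow_norm (critExpENN_ne_zero hN.out)
    critExpENN_ne_top (Lp.memLp _), critExpENN_toReal hN.out, ENNReal.toReal_ofReal (by positivity),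
    ← Real.rpow_mul (by positivity), inv_mul_cancel₀ (by linarith), Real.rpow_one]
  rfl

theorem integrable_rpow_mul_mul (a b c : LCrit N) :
    Integrable (fun y => |a y| ^ (critExp N - 2) * |b y| * |c y|) (weightedMeasure N) := by
  have hq := two_lt_critExp hN.out
  have hint : Integrable (fun y => ((critExp N - 2) * |a y| ^ critExp N + |b y| ^ critExp N +
      |c y| ^ critExp N) / critExp N) (weightedMeasure N) :=
    ((((integrable_abs_rpow a).const_mul _).add (integrable_abs_rpow b)).add
      (integrable_abs_rpow c)).div_const _
  refine hint.mono' ?_ (ae_of_all _ fun y => ?_)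
  · have h (f : LCrit N) : AEMeasurable f (weightedMeasure N) :=
      (Lp.aestronglyMeasurable f).aemeasurable
    have ha := h a
    have hb := h b
    have hc := h c
    apply AEMeasurable.aestronglyMeasurable
    exact ((ha.abs.pow_const _).mul hb.abs).mul hc.abs
  · rw [Real.norm_of_nonneg (by positivity)]
    have := rpow_mul_mul_le_weighted (r := critExp N - 2) (by linarith) (abs_nonneg (a y))
      (abs_nonneg (b y)) (abs_nonneg (c y))
    rwa [sub_add_cancel] at this

/-- Weighted AM-GM applied to the functions divided by `s`, `t`, `u`. Allowing these to exceed the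
norms avoids dividing by a zero norm; `integral_rpow_mul_mul_le` then lets the excess tend to zero.
-/
theorem integral_rpow_mul_mul_le_of_pos (a b c : LCrit N) {s t u : ℝ} (hs : 0 < s) (ht : 0 < t)
    (hu : 0 < u) (has : ‖a‖ ≤ s) (hbt : ‖b‖ ≤ t) (hcu : ‖c‖ ≤ u) :
    ∫ y, |a y| ^ (critExp N - 2) * |b y| * |c y| ∂(weightedMeasure N) ≤
      s ^ (critExp N - 2) * t * u := by
  have hq := two_lt_critExp hN.out
  set q := critExp N with hqdef
  have hpt (y : Space N) : |a y| ^ (q - 2) * |b y| * |c y| ≤ s ^ (q - 2) * t * u / q *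
      ((q - 2) * (s ^ q)⁻¹ * |a y| ^ q + (t ^ q)⁻¹ * |b y| ^ q + (u ^ q)⁻¹ * |c y| ^ q) := by
    have := rpow_mul_mul_le_weighted (r := q - 2) (a := |a y| / s) (b := |b y| / t)
      (c := |c y| / u) (by linarith) (by positivity) (by positivity) (by positivity)
    rw [sub_add_cancel, Real.div_rpow (by positivity) hs.le, Real.div_rpow (by positivity) hs.le,
      Real.div_rpow (by positivity) ht.le, Real.div_rpow (by positivity) hu.le] at this
    have h2 := mul_le_mul_of_nonneg_left this (by positivity : 0 ≤ s ^ (q - 2) * t * u)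
    calc _ = s ^ (q - 2) * t * u * (|a y| ^ (q - 2) / s ^ (q - 2) * (|b y| / t) * (|c y| / u)) := by
          field_simp
      _ ≤ _ := h2
      _ = _ := by ring
  have hbound {f : LCrit N} {x : ℝ} (hx : 0 < x) (h : ‖f‖ ≤ x) :
      (x ^ q)⁻¹ * ‖f‖ ^ q ≤ 1 := by
    rw [inv_mul_le_iff₀ (by positivity), mul_one]
    gcongr
  have i1 := (integrable_abs_rpow a).const_mul ((q - 2) * (s ^ q)⁻¹)
  have i2 := (integrable_abs_rpow b).const_mul (t ^ q)⁻¹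
  have i3 := (integrable_abs_rpow c).const_mul (u ^ q)⁻¹
  have i12 := i1.add i2
  calc _ ≤ ∫ y, s ^ (q - 2) * t * u / q *
      ((q - 2) * (s ^ q)⁻¹ * |a y| ^ q + (t ^ q)⁻¹ * |b y| ^ q + (u ^ q)⁻¹ * |c y| ^ q)
        ∂(weightedMeasure N) :=
        integral_mono (integrable_rpow_mul_mul a b c) ((i12.add i3).const_mul _) hpt
    _ = s ^ (q - 2) * t * u / q * ((q - 2) * ((s ^ q)⁻¹ * ‖a‖ ^ q) + (t ^ q)⁻¹ * ‖b‖ ^ q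
        + (u ^ q)⁻¹ * ‖c‖ ^ q) := by
        rw [integral_const_mul, integral_add (f := fun y => (q - 2) * (s ^ q)⁻¹ * |a y| ^ q +
          (t ^ q)⁻¹ * |b y| ^ q) i12 i3, integral_add i1 i2, integral_const_mul,
          integral_const_mul, integral_const_mul, integral_abs_rpow, integral_abs_rpow,
          integral_abs_rpow, mul_assoc (q - 2)]
    _ ≤ s ^ (q - 2) * t * u / q * ((q - 2) * 1 + 1 + 1) := by
        have h0 : 0 ≤ q - 2 := by linarith
        gcongr
        · exact hbound hs has
        · exact hbound ht hbt
        · exact hbound hu hcu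
    _ = _ := by field_simp; ring

theorem integral_rpow_mul_mul_le (a b c : LCrit N) :
    ∫ y, |a y| ^ (critExp N - 2) * |b y| * |c y| ∂(weightedMeasure N) ≤
      ‖a‖ ^ (critExp N - 2) * ‖b‖ * ‖c‖ := by
  have hq := two_lt_critExp hN.out
  have hcont : Continuous (fun ε : ℝ =>
      (‖a‖ + ε) ^ (critExp N - 2) * (‖b‖ + ε) * (‖c‖ + ε)) := by
    have : Continuous (fun ε : ℝ => (‖a‖ + ε) ^ (critExp N - 2)) :=
      (continuous_const.add continuous_id).rpow_const fun _ => Or.inr (by linarith)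
    fun_prop
  have hlim := (hcont.tendsto 0).mono_left (nhdsWithin_le_nhds (s := Ioi 0))
  simp only [add_zero] at hlim
  apply ge_of_tendsto hlim
  filter_upwards [self_mem_nhdsWithin] with ε hε
  have hε' : (0 : ℝ) < ε := hε
  exact integral_rpow_mul_mul_le_of_pos a b c (by positivity) (by positivity) (by positivity)
    (by linarith) (by linarith) (by linarith)

end Hoelder

/-! ### The derivative of the energy and local semiconvexity -/

section Derivative

variable {N : ℕ} [hN : Fact (3 ≤ N)]

/-- The derivative of `B / 2^*` at `v` in the direction `w`, as a form on `L^{2^*}_K`. -/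
def critForm (v w : LCrit N) : ℝ :=
  ∫ y, |v y| ^ (critExp N - 2) * v y * w y ∂(weightedMeasure N)

omit hN in
theorem aemeasurable_lCrit (f : LCrit N) : AEMeasurable f (weightedMeasure N) :=
  (Lp.aestronglyMeasurable f).aemeasurable

theorem integrable_critForm (v w : LCrit N) :
    Integrable (fun y => |v y| ^ (critExp N - 2) * v y * w y) (weightedMeasure N) := by
  refine (integrable_rpow_mul_mul v v w).mono' ?_ (ae_of_all _ fun y => ?_)
  · have hv := aemeasurable_lCrit v
    have hw := aemeasurable_lCrit w
    exact (((hv.abs.pow_const _).mul hv).mul hw).aestronglyMeasurable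
  · rw [norm_mul, norm_mul, Real.norm_of_nonneg (by positivity)]
    rfl

theorem critForm_sub_right (v w w' : LCrit N) :
    critForm v (w - w') = critForm v w - critForm v w' := by
  rw [critForm, critForm, critForm,
    ← integral_sub (integrable_critForm v w) (integrable_critForm v w')]
  apply integral_congr_ae
  filter_upwards [Lp.coeFn_sub w w'] with y hy
  rw [hy, Pi.sub_apply]
  ring

theorem abs_critForm_le (v w : LCrit N) :
    |critForm v w| ≤ ‖v‖ ^ (critExp N - 2) * ‖v‖ * ‖w‖ := by
  refine (abs_integral_le_integral_abs).trans ?_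
  refine le_trans (le_of_eq ?_) (integral_rpow_mul_mul_le v v w)
  congr 1
  ext y
  rw [abs_mul, abs_mul, abs_of_nonneg (Real.rpow_nonneg (abs_nonneg _) _)]

theorem continuous_critForm_right (v : LCrit N) : Continuous (critForm v) := by
  apply LipschitzWith.continuous (K := (‖v‖ ^ (critExp N - 2) * ‖v‖).toNNReal)
  apply LipschitzWith.of_dist_le_mul
  intro w w'
  rw [Real.dist_eq, dist_eq_norm, ← critForm_sub_right, Real.coe_toNNReal _ (by positivity)]
  exact abs_critForm_le _ _

theorem abs_critForm_sub_left_le (v v' w : LCrit N) :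
    |critForm v w - critForm v' w| ≤ (critExp N - 1) *
      ((‖v‖ ^ (critExp N - 2) + ‖v'‖ ^ (critExp N - 2)) * ‖v - v'‖ * ‖w‖) := by
  have hq := two_lt_critExp hN.out
  rw [critForm, critForm, ← integral_sub (integrable_critForm v w) (integrable_critForm v' w)]
  refine (abs_integral_le_integral_abs).trans ?_
  have i1 := integrable_rpow_mul_mul v (v - v') w
  have i2 := integrable_rpow_mul_mul v' (v - v') w
  calc _ ≤ ∫ y, (critExp N - 1) * (|v y| ^ (critExp N - 2) * |(v - v') y| * |w y| +
        |v' y| ^ (critExp N - 2) * |(v - v') y| * |w y|) ∂(weightedMeasure N) := by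
        apply integral_mono_of_nonneg (ae_of_all _ fun y => abs_nonneg _)
          ((i1.add i2).const_mul _)
        filter_upwards [Lp.coeFn_sub v v'] with y hy
        simp only [hy, Pi.sub_apply, Pi.add_apply]
        have h := abs_rpow_mul_self_sub_le (by linarith : 0 < critExp N - 2) (v y) (v' y)
        rw [← sub_mul, abs_mul]
        have h2 := mul_le_mul_of_nonneg_right h (abs_nonneg (w y))
        linarith
    _ = (critExp N - 1) * (∫ y, |v y| ^ (critExp N - 2) * |(v - v') y| * |w y|
          ∂(weightedMeasure N) + ∫ y, |v' y| ^ (critExp N - 2) * |(v - v') y| * |w y|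
          ∂(weightedMeasure N)) := by
        rw [integral_const_mul, integral_add i1 i2]
    _ ≤ _ := by
        have h1 := integral_rpow_mul_mul_le v (v - v') w
        have h2 := integral_rpow_mul_mul_le v' (v - v') w
        apply mul_le_mul_of_nonneg_left _ (by linarith)
        linarith

theorem continuous_critForm_left (w : LCrit N) : Continuous (fun v => critForm v w) := by
  have hq := two_lt_critExp hN.out
  rw [continuous_iff_continuousAt]
  intro v₀
  rw [ContinuousAt, tendsto_iff_dist_tendsto_zero]
  have hcont : Continuous (fun v : LCrit N => (critExp N - 1) *
      ((‖v‖ ^ (critExp N - 2) + ‖v₀‖ ^ (critExp N - 2)) * ‖v - v₀‖ * ‖w‖)) := by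
    have : Continuous (fun v : LCrit N => ‖v‖ ^ (critExp N - 2)) :=
      continuous_norm.rpow_const fun _ => Or.inr (by linarith)
    fun_prop
  have h := hcont.tendsto v₀
  simp only [sub_self, norm_zero, mul_zero, zero_mul] at h
  exact squeeze_zero (fun _ => dist_nonneg)
    (fun v => by rw [Real.dist_eq]; exact abs_critForm_sub_left_le v v₀ w) h

/-- The derivative of the energy at `v` in the direction `w`. -/
def energyDeriv (μ : ℝ) (v w : X N) : ℝ := bilin μ v w - critForm (critL N v) (critL N w)

theorem continuous_energyDeriv_right (μ : ℝ) (v : X N) : Continuous (energyDeriv μ v) := by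
  have h1 : Continuous (fun v : X N => v.grad) := (gradL N).continuous
  have h2 : Continuous (fun v : X N => v.fn) := (fnL N).continuous
  have h3 := (continuous_critForm_right (critL N v)).comp (critL N).continuous
  unfold energyDeriv bilin
  exact (by fun_prop : Continuous fun w : X N => ⟪v.grad, w.grad⟫_ℝ -
    μ * ⟪hardyL N v, hardyL N w⟫_ℝ - beta N * ⟪v.fn, w.fn⟫_ℝ).sub h3

theorem continuous_energyDeriv_left (μ : ℝ) (w : X N) :
    Continuous (fun v => energyDeriv μ v w) := by
  have h1 : Continuous (fun v : X N => v.grad) := (gradL N).continuous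
  have h2 : Continuous (fun v : X N => v.fn) := (fnL N).continuous
  have h3 := (continuous_critForm_left (critL N w)).comp (critL N).continuous
  unfold energyDeriv bilin
  exact (by fun_prop : Continuous fun v : X N => ⟪v.grad, w.grad⟫_ℝ -
    μ * ⟪hardyL N v, hardyL N w⟫_ℝ - beta N * ⟪v.fn, w.fn⟫_ℝ).sub h3

theorem energyDeriv_sub_right (μ : ℝ) (v w w' : X N) :
    energyDeriv μ v (w - w') = energyDeriv μ v w - energyDeriv μ v w' := by
  simp only [energyDeriv, bilin, ← fnL_apply, ← gradL_apply, map_sub, inner_sub_right,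
    critForm_sub_right]
  ring

theorem continuous_E (μ : ℝ) : Continuous (E μ : X N → ℝ) := by
  have h1 := continuous_A (N := N) μ
  have h2 := continuous_B (N := N)
  unfold E
  fun_prop

theorem continuous_Dδ (μ δ : ℝ) : Continuous (Dδ μ δ : X N → ℝ) := by
  have h1 := continuous_A (N := N) μ
  have h2 := continuous_B (N := N)
  unfold Dδ
  fun_prop

theorem B_eq_integral_critL (v : X N) :
    B v = ∫ y, |critL N v y| ^ critExp N ∂(weightedMeasure N) := by
  rw [B_eq, integral_abs_rpow]

/-- `A` has an exact second-order expansion, so the only loss is the Taylor remainder of `B / 2^*`,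
estimated by `remainder_le`. -/
theorem energy_lower_bound (μ : ℝ) (x z : X N) :
    E μ z + energyDeriv μ z (x - z) + A μ (x - z) / 2 - (critExp N - 1) *
      (∫ y, |critL N x y| ^ (critExp N - 2) * |critL N (x - z) y| * |critL N (x - z) y|
          ∂(weightedMeasure N) +
        ∫ y, |critL N z y| ^ (critExp N - 2) * |critL N (x - z) y| * |critL N (x - z) y|
          ∂(weightedMeasure N)) ≤ E μ x := by
  have hq := two_lt_critExp hN.out
  have i1 := integrable_rpow_mul_mul (critL N x) (critL N (x - z)) (critL N (x - z))
  have i2 := integrable_rpow_mul_mul (critL N z) (critL N (x - z)) (critL N (x - z))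
  have iB (v : X N) := (integrable_abs_rpow (critL N v)).div_const (critExp N)
  have ic := integrable_critForm (critL N z) (critL N (x - z))
  have key : B x / critExp N - B z / critExp N - critForm (critL N z) (critL N (x - z)) ≤
      (critExp N - 1) * (∫ y, |critL N x y| ^ (critExp N - 2) * |critL N (x - z) y| *
        |critL N (x - z) y| ∂(weightedMeasure N) +
        ∫ y, |critL N z y| ^ (critExp N - 2) * |critL N (x - z) y| * |critL N (x - z) y|
          ∂(weightedMeasure N)) := by
    rw [B_eq_integral_critL, B_eq_integral_critL, ← integral_div, ← integral_div, critForm,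
      ← integral_sub' (iB x) (iB z), ← integral_sub' ((iB x).sub (iB z)) ic, ← integral_add i1 i2,
      ← integral_const_mul]
    apply integral_mono_ae (((iB x).sub (iB z)).sub ic) ((i1.add i2).const_mul _)
    have hsub : (critL N (x - z) : Space N → ℝ) =ᵐ[weightedMeasure N]
        (critL N x : Space N → ℝ) - critL N z := by
      rw [map_sub]; exact Lp.coeFn_sub _ _
    filter_upwards [hsub] with y hy
    have h := remainder_le (by linarith : 0 < critExp N - 2) (critL N x y) (critL N z y)
    rw [sub_add_cancel] at h
    simp only [Pi.sub_apply, Pi.add_apply, hy]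
    linarith
  have hA := A_sub μ x z
  simp only [E, energyDeriv]
  linarith

omit hN in
theorem exists_bounded_near (v₀ : X N) {ε : ℝ} (hε : 0 < ε) : ∃ ψ : X N, ‖v₀ - ψ‖ < ε ∧
    ∃ M : ℝ, 0 ≤ M ∧ ∀ᵐ y ∂(weightedMeasure N), |ψ.fn y| ≤ M := by
  obtain ⟨p, hp, hdist⟩ := Metric.mem_closure_iff.1 v₀.2 ε hε
  refine ⟨⟨p, subset_closure hp⟩, ?_, ?_⟩
  · rwa [dist_eq_norm] at hdist
  · obtain ⟨φ, hφ, hc, e1, -⟩ := hp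
    obtain ⟨M, hM⟩ := hφ.continuous.bounded_above_of_compact_support hc
    refine ⟨M, (norm_nonneg _).trans (hM 0), ?_⟩
    filter_upwards [e1] with y hy
    change |p.1 y| ≤ M
    rw [hy]
    exact hM y

/-- At critical growth this integral is not controlled by the `L²_K` norm of `w`. Splitting `x` as
`(x - ψ) + ψ` with `ψ` bounded leaves an `X`-norm term with a small coefficient when `x` is near
`ψ`, plus an `L²_K` term. -/
theorem integral_rpow_mul_sq_le (x ψ w : X N) {M : ℝ}
    (hψ : ∀ᵐ y ∂(weightedMeasure N), |ψ.fn y| ≤ M) :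
    ∫ y, |critL N x y| ^ (critExp N - 2) * |critL N w y| * |critL N w y| ∂(weightedMeasure N) ≤
      2 ^ (critExp N - 2) * ((‖critL N‖ * ‖x - ψ‖) ^ (critExp N - 2) * (‖critL N‖ * ‖w‖) ^ 2 +
        M ^ (critExp N - 2) * ‖w.fn‖ ^ 2) := by
  have hq := two_lt_critExp hN.out
  have i1 := integrable_rpow_mul_mul (critL N x) (critL N w) (critL N w)
  have i2 := integrable_rpow_mul_mul (critL N (x - ψ)) (critL N w) (critL N w)
  have i3 := (integrable_norm_sq w.fn).const_mul (M ^ (critExp N - 2))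
  calc _ ≤ ∫ y, 2 ^ (critExp N - 2) * (|critL N (x - ψ) y| ^ (critExp N - 2) * |critL N w y| *
        |critL N w y| + M ^ (critExp N - 2) * ‖w.fn y‖ ^ 2) ∂(weightedMeasure N) := by
        apply integral_mono_ae i1 ((i2.add i3).const_mul _)
        have hsub : (critL N (x - ψ) : Space N → ℝ) =ᵐ[weightedMeasure N]
            (critL N x : Space N → ℝ) - critL N ψ := by
          rw [map_sub]; exact Lp.coeFn_sub _ _
        filter_upwards [hsub, hψ, coeFn_critL w, coeFn_critL ψ] with y hy hψy hw hψc
        have h := abs_rpow_le_two_rpow_mul (by linarith : 0 < critExp N - 2)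
          (critL N x y) (critL N ψ y)
        have hMy : |critL N ψ y| ^ (critExp N - 2) ≤ M ^ (critExp N - 2) := by
          rw [hψc]
          exact Real.rpow_le_rpow (abs_nonneg _) hψy (by linarith)
        have h2 : |critL N x y| ^ (critExp N - 2) ≤ 2 ^ (critExp N - 2) *
            (|critL N x y - critL N ψ y| ^ (critExp N - 2) + M ^ (critExp N - 2)) :=
          h.trans (by gcongr)
        simp only [Pi.add_apply, hy, Pi.sub_apply, ← hw, Real.norm_eq_abs]
        have h3 := mul_le_mul_of_nonneg_right h2 (mul_self_nonneg |critL N w y|)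
        linarith
    _ = 2 ^ (critExp N - 2) * (∫ y, |critL N (x - ψ) y| ^ (critExp N - 2) * |critL N w y| *
        |critL N w y| ∂(weightedMeasure N) + M ^ (critExp N - 2) * ‖w.fn‖ ^ 2) := by
        rw [integral_const_mul, integral_add i2 i3, integral_const_mul, ← norm_sq_eq_integral]
    _ ≤ _ := by
        gcongr
        refine (integral_rpow_mul_mul_le _ _ _).trans ?_
        rw [mul_assoc, ← sq]
        have h1 := (critL N).le_opNorm (x - ψ)
        have h2 := (critL N).le_opNorm w
        gcongr

/-- The small `X`-norm part of the remainder is absorbed by the coercive term `A(x - z)/2`, so only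
an `L²_K` error survives. -/
theorem exists_local_semiconvexity {μ : ℝ} (hμ : μ ≤ ((N : ℝ) - 2) ^ 2 / 8) (v₀ : X N) :
    ∃ ε > 0, ∃ C : ℝ, 0 ≤ C ∧ ∀ x z : X N, ‖x - v₀‖ < ε → ‖z - v₀‖ < ε →
      E μ z + energyDeriv μ z (x - z) - C * ‖(x - z).fn‖ ^ 2 ≤ E μ x := by
  have hq := two_lt_critExp hN.out
  have hN' : (3 : ℝ) ≤ N := by exact_mod_cast hN.out
  -- The bound `1 / (2N)` is the coercivity constant of `A / 2`. The radius is `2ε` because `x` and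
  -- `z` lie within `ε` of `v₀`, and so does `ψ`.
  obtain ⟨ε, hε, hsmall⟩ : ∃ ε > 0, (critExp N - 1) * (2 * 2 ^ (critExp N - 2) *
      ((‖critL N‖ * (2 * ε)) ^ (critExp N - 2) * ‖critL N‖ ^ 2)) < 1 / (2 * N) := by
    have hcont : Continuous (fun ε : ℝ => (critExp N - 1) * (2 * 2 ^ (critExp N - 2) *
      ((‖critL N‖ * (2 * ε)) ^ (critExp N - 2) * ‖critL N‖ ^ 2))) := by
      have : Continuous (fun ε : ℝ => (‖critL N‖ * (2 * ε)) ^ (critExp N - 2)) :=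
        (by fun_prop : Continuous fun ε : ℝ => ‖critL N‖ * (2 * ε)).rpow_const
          fun _ => Or.inr (by linarith)
      fun_prop
    have hlim := (hcont.tendsto 0).mono_left (nhdsWithin_le_nhds (s := Ioi 0))
    rw [mul_zero, mul_zero, Real.zero_rpow (by linarith), zero_mul, mul_zero, mul_zero] at hlim
    have hev := hlim.eventually_lt_const (by positivity : (0 : ℝ) < 1 / (2 * N))
    obtain ⟨ε, h1, h2⟩ := (hev.and self_mem_nhdsWithin).exists
    exact ⟨ε, h2, h1⟩
  obtain ⟨ψ, hψ, M, hM, hMψ⟩ := exists_bounded_near v₀ hε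
  refine ⟨ε, hε, (critExp N - 1) * (2 * 2 ^ (critExp N - 2) * M ^ (critExp N - 2)), ?_, ?_⟩
  · have : 0 ≤ critExp N - 1 := by linarith
    positivity
  intro x z hx hz
  have hbound {u : X N} (hu : ‖u - v₀‖ < ε) :
      ∫ y, |critL N u y| ^ (critExp N - 2) * |critL N (x - z) y| * |critL N (x - z) y|
        ∂(weightedMeasure N) ≤ 2 ^ (critExp N - 2) * ((‖critL N‖ * (2 * ε)) ^ (critExp N - 2) *
        (‖critL N‖ * ‖x - z‖) ^ 2 + M ^ (critExp N - 2) * ‖(x - z).fn‖ ^ 2) := by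
    refine (integral_rpow_mul_sq_le u ψ (x - z) hMψ).trans ?_
    have : ‖u - ψ‖ ≤ 2 * ε := by
      have := norm_add_le (u - v₀) (v₀ - ψ)
      rw [sub_add_sub_cancel] at this
      linarith
    gcongr
  have h1 := energy_lower_bound μ x z
  have h2 := norm_sq_div_le_A hμ (x - z)
  have h3 := mul_le_mul_of_nonneg_left (add_le_add (hbound hx) (hbound hz))
    (by linarith : 0 ≤ critExp N - 1)
  have h4 := mul_le_mul_of_nonneg_right hsmall.le (sq_nonneg ‖x - z‖)
  have h5 : 1 / (2 * (N : ℝ)) * ‖x - z‖ ^ 2 = ‖x - z‖ ^ 2 / N / 2 := by field_simp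
  linarith

end Derivative

/-! ### Monotonicity from a local dissipation inequality -/

section Dissipation

section Hilbert

variable {H : Type*} [NormedAddCommGroup H] [InnerProductSpace ℝ H] [CompleteSpace H]

omit [CompleteSpace H] in
-- The increments are dominated by those of the primitive of `‖g‖`. Absolute continuity justifies
-- the fundamental theorem of calculus for `‖∫ g‖²` when `g` is merely integrable.
theorem absolutelyContinuousOnInterval_norm_sq_primitive {g : ℝ → H} {a b : ℝ} (hab : a ≤ b)
    (hg : IntervalIntegrable g volume a b) :
    AbsolutelyContinuousOnInterval (fun t => ‖∫ σ in a..t, g σ‖ ^ 2) a b := by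
  have hΦ := hg.norm.absolutelyContinuousOnInterval_intervalIntegral (c := a) left_mem_uIcc
  set M : ℝ := ∫ σ in a..b, ‖g σ‖ with hM
  have hM0 : 0 ≤ M := intervalIntegral.integral_nonneg hab fun _ _ => norm_nonneg _
  have hsub {s t : ℝ} (hs : s ∈ uIcc a b) (ht : t ∈ uIcc a b) :
      IntervalIntegrable g volume s t := hg.mono_set (uIcc_subset_uIcc hs ht)
  have hbd {t : ℝ} (ht : t ∈ uIcc a b) : ‖∫ σ in a..t, g σ‖ ≤ M := by
    have ht' := ht
    rw [uIcc_of_le hab] at ht'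
    refine (intervalIntegral.norm_integral_le_integral_norm ht'.1).trans ?_
    exact intervalIntegral.integral_mono_interval le_rfl ht'.1 ht'.2
      (ae_of_all _ fun _ => norm_nonneg _) hg.norm
  have hdist {s t : ℝ} (hs : s ∈ uIcc a b) (ht : t ∈ uIcc a b) :
      dist (‖∫ σ in a..s, g σ‖ ^ 2) (‖∫ σ in a..t, g σ‖ ^ 2) ≤
        2 * M * dist (∫ σ in a..s, ‖g σ‖) (∫ σ in a..t, ‖g σ‖) := by
    rw [Real.dist_eq, Real.dist_eq, intervalIntegral.integral_interval_sub_left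
      (hsub left_mem_uIcc hs).norm (hsub left_mem_uIcc ht).norm, sq_sub_sq, abs_mul]
    have h1 : |‖∫ σ in a..s, g σ‖ - ‖∫ σ in a..t, g σ‖| ≤ |∫ σ in t..s, ‖g σ‖| := by
      refine (abs_norm_sub_norm_le _ _).trans ?_
      rw [intervalIntegral.integral_interval_sub_left (hsub left_mem_uIcc hs)
        (hsub left_mem_uIcc ht)]
      exact intervalIntegral.norm_integral_le_abs_integral_norm
    have h2 : |‖∫ σ in a..s, g σ‖ + ‖∫ σ in a..t, g σ‖| ≤ 2 * M := by
      rw [abs_of_nonneg (by positivity)]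
      linarith [hbd hs, hbd ht]
    gcongr
  rw [absolutelyContinuousOnInterval_iff] at hΦ ⊢
  intro ε hε
  obtain ⟨δ, hδ, h⟩ := hΦ (ε / (2 * M + 1)) (by positivity)
  refine ⟨δ, hδ, fun E hE hsum => ?_⟩
  have h1 := h E hE hsum
  rw [lt_div_iff₀ (by positivity)] at h1
  refine lt_of_le_of_lt ?_ h1
  calc _ ≤ ∑ i ∈ Finset.range E.1, 2 * M * dist (∫ σ in a..(E.2 i).1, ‖g σ‖)
        (∫ σ in a..(E.2 i).2, ‖g σ‖) :=
        Finset.sum_le_sum fun i hi => hdist (hE.1 i hi).1 (hE.1 i hi).2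
    _ ≤ _ := by
        rw [← Finset.mul_sum, mul_comm]
        gcongr
        linarith

theorem ae_deriv_norm_sq_primitive {g : ℝ → H} {a b : ℝ} (hg : IntervalIntegrable g volume a b) :
    ∀ᵐ t, t ∈ uIcc a b → deriv (fun t => ‖∫ σ in a..t, g σ‖ ^ 2) t =
      2 * ⟪g t, ∫ σ in a..t, g σ⟫_ℝ := by
  filter_upwards [hg.ae_hasDerivAt_integral] with t ht htm
  have h := (ht htm a left_mem_uIcc).norm_sq
  rw [h.deriv, real_inner_comm]

theorem intervalIntegrable_inner_primitive {g : ℝ → H} {a b : ℝ} (hab : a ≤ b)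
    (hg : IntervalIntegrable g volume a b) :
    IntervalIntegrable (fun t => ⟪g t, ∫ σ in a..t, g σ⟫_ℝ) volume a b := by
  have h := (absolutelyContinuousOnInterval_norm_sq_primitive hab hg).intervalIntegrable_deriv
  refine (h.const_mul (1 / 2)).congr_ae ?_
  rw [EventuallyEq, ae_restrict_iff' measurableSet_uIoc]
  filter_upwards [ae_deriv_norm_sq_primitive hg] with t ht htm
  rw [ht (uIoc_subset_uIcc htm)]
  ring

theorem integral_inner_primitive {g : ℝ → H} {a b : ℝ} (hab : a ≤ b)
    (hg : IntervalIntegrable g volume a b) :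
    ∫ t in a..b, ⟪g t, ∫ σ in a..t, g σ⟫_ℝ = ‖∫ σ in a..b, g σ‖ ^ 2 / 2 := by
  have h := (absolutelyContinuousOnInterval_norm_sq_primitive hab hg).integral_deriv_eq_sub
  rw [intervalIntegral.integral_congr_ae (g := fun t => 2 * ⟪g t, ∫ σ in a..t, g σ⟫_ℝ) (by
    filter_upwards [ae_deriv_norm_sq_primitive hg] with t ht htm
    exact ht (uIoc_subset_uIcc htm)), intervalIntegral.integral_const_mul] at h
  simp only [intervalIntegral.integral_same, norm_zero] at h
  linarith

/-- A continuous function that decreases along `u = ∫ g`, up to a quadratic error in `u`,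
is nonincreasing. -/
theorem le_of_local_dissipation {f : ℝ → ℝ} {g : ℝ → H} {a b : ℝ} (hab : a ≤ b)
    (hf : ContinuousOn f (Icc a b)) (hg : IntervalIntegrable g volume a b)
    (h : ∀ c ∈ Ico a b, ∃ η > 0, ∃ C : ℝ, 0 ≤ C ∧ ∀ᵐ τ, τ ∈ Ioo c (c + η) → τ < b →
      f τ - f c ≤ -⟪g τ, ∫ σ in c..τ, g σ⟫_ℝ + C * ‖∫ σ in c..τ, g σ‖ ^ 2) :
    f b ≤ f a := by
  by_contra! hlt
  have hab' : a < b := lt_of_le_of_ne hab (by rintro rfl; exact lt_irrefl _ hlt)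
  set ε : ℝ := (f b - f a) / (2 * (b - a)) with hεdef
  have hε : 0 < ε := div_pos (by linarith) (by linarith)
  have hεeq : ε * (b - a) = (f b - f a) / 2 := by
    have : b - a ≠ 0 := by linarith
    rw [hεdef]; field_simp
  -- If `f b > f a`, this tilted function still ends above its initial value, so it has a minimum at
  -- some `c < b`, and `f > f c` to the right of `c`.
  have hF : ContinuousOn (fun t => f t - ε * (t - a)) (Icc a b) := by fun_prop
  obtain ⟨c, hc, hmin⟩ := isCompact_Icc.exists_isMinOn ⟨a, left_mem_Icc.2 hab⟩ hF
  have hcmin {t : ℝ} (ht : t ∈ Icc a b) : f c - ε * (c - a) ≤ f t - ε * (t - a) := hmin ht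
  have hcb : c < b := by
    refine lt_of_le_of_ne hc.2 ?_
    rintro rfl
    have := hcmin (left_mem_Icc.2 hab)
    rw [sub_self, mul_zero, hεeq] at this
    linarith
  obtain ⟨η, hη, C, hC, hae⟩ := h c ⟨hc.1, hcb⟩
  -- The interval is short enough that `C (m - c) ≤ 1/2`.
  set m : ℝ := min (c + η) (min b (c + 1 / (2 * (C + 1)))) with hm
  have hcm : c < m := by
    have : 0 < 1 / (2 * (C + 1)) := by positivity
    rw [hm]
    exact lt_min (by linarith) (lt_min hcb (by linarith))
  have hmb : m ≤ b := (min_le_right _ _).trans (min_le_left _ _)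
  have hmη : m ≤ c + η := min_le_left _ _
  have hmC : C * (m - c) ≤ 1 / 2 := by
    have h1 : m - c ≤ 1 / (2 * (C + 1)) := by
      linarith [(min_le_right (c + η) _).trans (min_le_right b (c + 1 / (2 * (C + 1))))]
    calc C * (m - c) ≤ (C + 1) * (1 / (2 * (C + 1))) := by
          gcongr
          linarith
      _ = 1 / 2 := by field_simp
  have hgi {t : ℝ} (ht : t ∈ Icc c m) : IntervalIntegrable g volume c t := by
    apply hg.mono_set
    rw [uIcc_of_le hab, uIcc_of_le ht.1]
    exact Icc_subset_Icc hc.1 (ht.2.trans hmb)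
  set G : ℝ → H := fun t => ∫ σ in c..t, g σ with hG
  have hGcont : ContinuousOn G (Icc c m) := by
    have := intervalIntegral.continuousOn_primitive_interval' (hgi (right_mem_Icc.2 hcm.le))
      left_mem_uIcc
    rwa [uIcc_of_le hcm.le] at this
  -- With `d` maximizing `‖G‖`, the integrated error is at most `‖G d‖²/2`, which the exact integral
  -- of `⟪g, G⟫` cancels. Hence the integral of `f - f c` is nonpositive, a contradiction. If the
  -- maximum is at `c`, then `G` vanishes and `m` serves.
  obtain ⟨d, hd, hcd, hmax⟩ : ∃ d ∈ Icc c m, c < d ∧ ∀ t ∈ Icc c d, ‖G t‖ ≤ ‖G d‖ := by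
    obtain ⟨d, hd, hmax⟩ := isCompact_Icc.exists_isMaxOn ⟨c, left_mem_Icc.2 hcm.le⟩ hGcont.norm
    have hmax' {t : ℝ} (ht : t ∈ Icc c m) : ‖G t‖ ≤ ‖G d‖ := hmax ht
    rcases eq_or_lt_of_le hd.1 with rfl | hlt
    · refine ⟨m, right_mem_Icc.2 hcm.le, hcm, fun t ht => ?_⟩
      refine (hmax' ht).trans ?_
      simp [hG]
    · exact ⟨d, hd, hlt, fun t ht => hmax' ⟨ht.1, ht.2.trans hd.2⟩⟩
  have hsubs : Icc c d ⊆ Icc c m := Icc_subset_Icc le_rfl hd.2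
  have hfi : IntervalIntegrable (fun t => f t - f c) volume c d := by
    apply ContinuousOn.intervalIntegrable
    rw [uIcc_of_le hcd.le]
    exact (hf.mono (Icc_subset_Icc hc.1 (hd.2.trans hmb))).sub continuousOn_const
  have hpos : 0 < ∫ t in c..d, (f t - f c) := by
    apply intervalIntegral.intervalIntegral_pos_of_pos_on hfi _ hcd
    intro t ht
    have h1 := hcmin (t := t) ⟨hc.1.trans ht.1.le, (ht.2.le.trans hd.2).trans hmb⟩
    nlinarith [ht.1]
  have hGi : IntervalIntegrable (fun t => C * ‖G t‖ ^ 2) volume c d := by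
    apply ContinuousOn.intervalIntegrable
    rw [uIcc_of_le hcd.le]
    exact ((hGcont.mono hsubs).norm.pow 2).const_smul C
  have hii := intervalIntegrable_inner_primitive hcd.le (hgi hd)
  have hle : ∫ t in c..d, (f t - f c) ≤ ∫ t in c..d, (-⟪g t, G t⟫_ℝ + C * ‖G t‖ ^ 2) := by
    rw [intervalIntegral.integral_of_le hcd.le, intervalIntegral.integral_of_le hcd.le,
      integral_Ioc_eq_integral_Ioo, integral_Ioc_eq_integral_Ioo]
    refine setIntegral_mono_ae_restrict (hfi.1.mono_set Ioo_subset_Ioc_self)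
      ((hii.neg.add hGi).1.mono_set Ioo_subset_Ioc_self) ?_
    rw [EventuallyLE, ae_restrict_iff' measurableSet_Ioo]
    filter_upwards [hae] with t ht htm
    exact ht ⟨htm.1, htm.2.trans_le (hd.2.trans hmη)⟩ (htm.2.trans_le (hd.2.trans hmb))
  have hle2 : ∫ t in c..d, C * ‖G t‖ ^ 2 ≤ C * ‖G d‖ ^ 2 * (d - c) := by
    calc _ ≤ ∫ t in c..d, C * ‖G d‖ ^ 2 := by
          apply intervalIntegral.integral_mono_on hcd.le hGi (by simp)
          intro t ht
          have := hmax t ht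
          gcongr
      _ = _ := by rw [intervalIntegral.integral_const, smul_eq_mul, mul_comm]
  have hni : IntervalIntegrable (fun t => -⟪g t, G t⟫_ℝ) volume c d := hii.neg
  rw [intervalIntegral.integral_add hni hGi, intervalIntegral.integral_neg,
    integral_inner_primitive hcd.le (hgi hd)] at hle
  have h3 : C * (d - c) ≤ 1 / 2 := by
    refine le_trans ?_ hmC
    gcongr
    exact hd.2
  have h4 := mul_le_mul_of_nonneg_right h3 (sq_nonneg ‖G d‖)
  have h5 : ‖∫ σ in c..d, g σ‖ = ‖G d‖ := rfl
  rw [h5] at hle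
  linarith

end Hilbert

end Dissipation

/-! ### The energy inequality for weak solutions -/

section Flow

variable {N : ℕ} [hN : Fact (3 ≤ N)]

theorem integral_source_eq (μ : ℝ) (v w : X N) :
    ∫ y, (|v.fn y| ^ (critExp N - 2) * v.fn y + μ * (v.fn y / ‖y‖ ^ 2)
      + beta N * v.fn y) * w.fn y ∂(weightedMeasure N) =
    critForm (critL N v) (critL N w) + μ * ⟪hardyL N v, hardyL N w⟫_ℝ
      + beta N * ⟪v.fn, w.fn⟫_ℝ := by
  have i1 := integrable_critForm (critL N v) (critL N w)
  have i2 := (L2.integrable_inner (𝕜 := ℝ) (hardyL N v) (hardyL N w)).const_mul μ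
  have i3 := (L2.integrable_inner (𝕜 := ℝ) v.fn w.fn).const_mul (beta N)
  rw [critForm, L2.inner_def, L2.inner_def, ← integral_const_mul, ← integral_const_mul,
    ← integral_add' i1 i2, ← integral_add' (i1.add i2) i3]
  apply integral_congr_ae
  filter_upwards [coeFn_critL v, coeFn_critL w, coeFn_hardyL v, coeFn_hardyL w] with y h1 h2 h3 h4
  simp only [Pi.add_apply, h1, h2, h3, h4, RCLike.inner_apply, conj_trivial]
  ring

theorem source_eq (μ : ℝ) (v w : X N) :
    ∫ y, (|v.fn y| ^ (critExp N - 2) * v.fn y + μ * (v.fn y / ‖y‖ ^ 2)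
      + beta N * v.fn y) * w.fn y ∂(weightedMeasure N) =
    ⟪v.grad, w.grad⟫_ℝ - energyDeriv μ v w := by
  rw [integral_source_eq, energyDeriv, bilin]
  ring

/-- A function all of whose primitives vanish is zero almost everywhere. -/
theorem ae_eq_zero_of_forall_integral_eq_zero {F : ℝ → ℝ} {T : ℝ} (hT : 0 ≤ T)
    (hF : IntervalIntegrable F volume 0 T)
    (h : ∀ s ∈ Ioo 0 T, ∫ τ in (0 : ℝ)..s, F τ = 0) : ∀ᵐ τ, τ ∈ Ioo 0 T → F τ = 0 := by
  filter_upwards [hF.ae_hasDerivAt_integral] with τ hτ hm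
  have h1 := hτ (by rw [uIcc_of_le hT]; exact Ioo_subset_Icc_self hm) 0 left_mem_uIcc
  have h2 : HasDerivAt (fun x => ∫ t in (0 : ℝ)..x, F t) 0 τ := by
    refine (hasDerivAt_const τ (0 : ℝ)).congr_of_eventuallyEq ?_
    filter_upwards [isOpen_Ioo.mem_nhds hm] with s hs
    exact h s hs
  exact h1.unique h2

section WeakSolution

variable {μ : ℝ} {v : ℝ → X N} {v' : ℝ → L2K N} {T : ℝ}

theorem ae_weak_form (hT : 0 < T) (hv : ContinuousOn v (Icc 0 T))
    (hv' : MemLp v' 2 (volume.restrict (Ioo 0 T)))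
    (hw : ∀ w : X N, ∀ s ∈ Ioo 0 T,
      ∫ τ in (0 : ℝ)..s, (inner ℝ (v' τ) w.fn + inner ℝ (v τ).grad w.grad) =
        ∫ τ in (0 : ℝ)..s, ∫ y,
          (|(v τ).fn y| ^ (critExp N - 2) * (v τ).fn y + μ * ((v τ).fn y / ‖y‖ ^ 2)
            + beta N * (v τ).fn y) * w.fn y ∂(weightedMeasure N)) (w : X N) :
    ∀ᵐ τ, τ ∈ Ioo 0 T → ⟪v' τ, w.fn⟫_ℝ + energyDeriv μ (v τ) w = 0 := by
  have hgradc : ContinuousOn (fun τ => ⟪(v τ).grad, w.grad⟫_ℝ) (Icc 0 T) :=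
    ((gradL N).continuous.comp_continuousOn hv).inner continuousOn_const
  have henc : ContinuousOn (fun τ => energyDeriv μ (v τ) w) (Icc 0 T) :=
    (continuous_energyDeriv_left μ w).comp_continuousOn hv
  have hgi : IntervalIntegrable (fun τ => ⟪(v τ).grad, w.grad⟫_ℝ) volume 0 T :=
    (hgradc.mono (uIcc_of_le hT.le).subset).intervalIntegrable
  have hei : IntervalIntegrable (fun τ => energyDeriv μ (v τ) w) volume 0 T :=
    (henc.mono (uIcc_of_le hT.le).subset).intervalIntegrable
  have hdi : IntervalIntegrable (fun τ => ⟪v' τ, w.fn⟫_ℝ) volume 0 T := by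
    rw [intervalIntegrable_iff_integrableOn_Ioo_of_le hT.le]
    exact (hv'.integrable (by norm_num)).inner_const w.fn
  apply ae_eq_zero_of_forall_integral_eq_zero hT.le (hdi.add hei)
  intro s hs
  have hsub : uIcc 0 s ⊆ uIcc 0 T := by
    rw [uIcc_of_le hs.1.le, uIcc_of_le hT.le]
    exact Icc_subset_Icc le_rfl hs.2.le
  have h := hw w s hs
  simp_rw [source_eq] at h
  rw [intervalIntegral.integral_add (hdi.mono_set hsub) (hgi.mono_set hsub),
    intervalIntegral.integral_sub (hgi.mono_set hsub) (hei.mono_set hsub)] at h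
  rw [intervalIntegral.integral_add (hdi.mono_set hsub) (hei.mono_set hsub)]
  linarith

/-- The exceptional null set depends on the test function. Testing with `v(r)` for rational `r`
gives one null set, and continuity in `X` extends the identity to all `s`. -/
theorem ae_weak_form_along (hT : 0 < T) (hv : ContinuousOn v (Icc 0 T))
    (hw : ∀ w : X N, ∀ᵐ τ, τ ∈ Ioo 0 T → ⟪v' τ, w.fn⟫_ℝ + energyDeriv μ (v τ) w = 0) :
    ∀ᵐ τ, τ ∈ Ioo 0 T → ∀ s ∈ Icc 0 T,
      ⟪v' τ, (v s).fn⟫_ℝ + energyDeriv μ (v τ) (v s) = 0 := by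
  have hrat : ∀ᵐ τ, ∀ r : ℚ, τ ∈ Ioo 0 T →
      ⟪v' τ, (v r).fn⟫_ℝ + energyDeriv μ (v τ) (v r) = 0 :=
    ae_all_iff.2 fun r => hw (v r)
  filter_upwards [hrat] with τ hτ hm
  have hcont : ContinuousOn (fun s => ⟪v' τ, (v s).fn⟫_ℝ + energyDeriv μ (v τ) (v s))
      (Icc 0 T) :=
    (continuousOn_const.inner ((fnL N).continuous.comp_continuousOn hv)).add
      ((continuous_energyDeriv_right μ (v τ)).comp_continuousOn hv)
  have hdense : Icc 0 T ⊆ closure (Ioo 0 T ∩ range ((↑) : ℚ → ℝ)) := by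
    rw [← closure_Ioo hT.ne]
    exact closure_minimal (Rat.denseRange_cast.open_subset_closure_inter isOpen_Ioo)
      isClosed_closure
  have heq : EqOn (fun s => ⟪v' τ, (v s).fn⟫_ℝ + energyDeriv μ (v τ) (v s)) (fun _ => 0)
      (Ioo 0 T ∩ range ((↑) : ℚ → ℝ)) := by
    rintro _ ⟨-, r, rfl⟩
    exact hτ r hm
  exact heq.of_subset_closure hcont continuousOn_const
    (inter_subset_left.trans Ioo_subset_Icc_self) hdense

theorem IsWeakSolution.energy_le {v₀ : X N} (hμ : μ ≤ ((N : ℝ) - 2) ^ 2 / 8)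
    (hsol : IsWeakSolution μ v₀ v T) (hv : ContinuousOn v (Icc 0 T)) {s : ℝ} (hs : 0 ≤ s)
    (hsT : s < T) : E μ (v s) ≤ E μ v₀ := by
  have hT : 0 < T := hs.trans_lt hsT
  obtain ⟨v', hv', hprim, hw⟩ := hsol.exists_deriv
  have hae := ae_weak_form_along hT hv (ae_weak_form hT hv hv' hw)
  have hgi : IntervalIntegrable v' volume 0 T := by
    rw [intervalIntegrable_iff_integrableOn_Ioo_of_le hT.le]
    exact hv'.integrable (by norm_num)
  have hgis {t : ℝ} (ht : t ∈ Ico 0 T) : IntervalIntegrable v' volume 0 t := by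
    apply hgi.mono_set
    rw [uIcc_of_le hT.le, uIcc_of_le ht.1]
    exact Icc_subset_Icc le_rfl ht.2.le
  have hprim0 {t : ℝ} (ht : t ∈ Ico 0 T) : (v t).fn = (v 0).fn + ∫ τ in (0 : ℝ)..t, v' τ := by
    rcases eq_or_lt_of_le ht.1 with rfl | h0
    · simp
    · exact hprim t ⟨h0, ht.2⟩
  rw [← hsol.initial]
  refine le_of_local_dissipation (f := fun t => E μ (v t)) hs
    (((continuous_E μ).comp_continuousOn hv).mono (Icc_subset_Icc le_rfl hsT.le))
    (hgis ⟨hs, hsT⟩) ?_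
  intro c hc
  have hcT : c ∈ Ico 0 T := ⟨hc.1, hc.2.trans hsT⟩
  obtain ⟨ε, hε, C, hC, hconv⟩ := exists_local_semiconvexity hμ (v c)
  have hnear : ∀ᶠ t in 𝓝[Icc 0 T] c, ‖v t - v c‖ < ε := by
    have := (hv c ⟨hcT.1, hcT.2.le⟩).eventually (Metric.ball_mem_nhds (v c) hε)
    filter_upwards [this] with t ht
    rwa [dist_eq_norm] at ht
  rw [eventually_nhdsWithin_iff, Metric.eventually_nhds_iff] at hnear
  obtain ⟨η, hη, hnear⟩ := hnear
  refine ⟨η, hη, C, hC, ?_⟩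
  filter_upwards [hae] with τ hτ hτc hτs
  have hτT : τ ∈ Ioo 0 T := ⟨hc.1.trans_lt hτc.1, hτs.trans hsT⟩
  have hτn : ‖v τ - v c‖ < ε := by
    refine hnear ?_ (Ioo_subset_Icc_self hτT)
    rw [Real.dist_eq, abs_of_pos (by linarith [hτc.1])]
    linarith [hτc.2]
  have h1 := hτ hτT τ (Ioo_subset_Icc_self hτT)
  have h2 := hτ hτT c ⟨hcT.1, hcT.2.le⟩
  -- Semiconvexity is expanded at the later point `v τ`, where the equation identifies the
  -- derivative of the energy with `-v' τ`.
  have h3 := hconv (v c) (v τ) (by simpa using hε) hτn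
  have hΔ : ∫ σ in c..τ, v' σ = (v τ).fn - (v c).fn := by
    rw [hprim0 hcT, hprim0 (Ioo_subset_Ico_self hτT), add_sub_add_left_eq_sub,
      intervalIntegral.integral_interval_sub_left (hgis (Ioo_subset_Ico_self hτT)) (hgis hcT)]
  have h4 : (v c - v τ).fn = -((v τ).fn - (v c).fn) := by
    rw [neg_sub]; rfl
  rw [energyDeriv_sub_right, h4, norm_neg] at h3
  rw [hΔ, inner_sub_right]
  linarith

end WeakSolution

theorem IsWeakSolutionUpTo.continuousOn_X {μ : ℝ} {v₀ : X N} {v : ℝ → X N} {S : EReal}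
    (hsol : IsWeakSolutionUpTo μ v₀ v S) : ContinuousOn v {s : ℝ | 0 ≤ s ∧ (s : EReal) < S} := by
  have hiso : Isometry (gradL N) :=
    AddMonoidHomClass.isometry_of_norm _ fun v => (norm_eq_norm_grad hN.out v).symm
  exact hiso.isUniformInducing.isInducing.continuousOn_iff.2 hsol.continuousOn

theorem IsWeakSolutionUpTo.energy_le {μ : ℝ} {v₀ : X N} {v : ℝ → X N} {S : EReal}
    (hμ : μ ≤ ((N : ℝ) - 2) ^ 2 / 8) (hsol : IsWeakSolutionUpTo μ v₀ v S) {s : ℝ} (hs : 0 ≤ s)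
    (hsS : (s : EReal) < S) : E μ (v s) ≤ E μ v₀ := by
  obtain ⟨T, hsT, hTS⟩ := EReal.lt_iff_exists_real_btwn.1 hsS
  have hsT' : s < T := by exact_mod_cast hsT
  refine (hsol.weak T (hs.trans_lt hsT') hTS).energy_le hμ (hsol.continuousOn_X.mono ?_) hs hsT'
  intro t ht
  exact ⟨ht.1, lt_of_le_of_lt (by exact_mod_cast ht.2) hTS⟩

end Flow

/-! ### The depth function and the sign of `D_{K,δ}` -/

section Wells

/-- The profile of the depth function: `d(δ)` is a multiple of
`(1 / 2 - δ / q) δ ^ (2 / (q - 2))`. -/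
def depthProfile (q δ : ℝ) : ℝ := (1 / 2 - δ / q) * δ ^ (2 / (q - 2))

theorem depthProfile_pos {q δ : ℝ} (hδ : 0 < δ) (hδq : 0 < 1 / 2 - δ / q) :
    0 < depthProfile q δ := mul_pos hδq (Real.rpow_pos_of_pos hδ _)

/-- The logarithm of the profile is a concave function plus a positive multiple of the strictly
concave `log`. -/
theorem min_lt_depthProfile {q a b c : ℝ} (hq : 2 < q) (ha : 0 < a) (hab : a < b) (hbc : b < c)
    (hc : 0 < 1 / 2 - c / q) :
    min (depthProfile q a) (depthProfile q c) < depthProfile q b := by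
  have hq0 : 0 < q := by linarith
  have hb : 0 < b := ha.trans hab
  have hac : a < c := hab.trans hbc
  have hbq : 0 < 1 / 2 - b / q := by
    have : b / q < c / q := by gcongr
    linarith
  have haq : 0 < 1 / 2 - a / q := by
    have : a / q < b / q := by gcongr
    linarith
  have hθ : 0 < 2 / (q - 2) := div_pos (by norm_num) (by linarith)
  have hlog {x : ℝ} (hx : 0 < x) (hxq : 0 < 1 / 2 - x / q) :
      Real.log (depthProfile q x) = Real.log (1 / 2 - x / q) + 2 / (q - 2) * Real.log x := by
    rw [depthProfile, Real.log_mul hxq.ne' (Real.rpow_pos_of_pos hx _).ne', Real.log_rpow hx]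
  obtain ⟨s, t, hs, ht, hst, hsum⟩ : ∃ s t : ℝ, 0 < s ∧ 0 < t ∧ s + t = 1 ∧ s * a + t * c = b := by
    have hne : c - a ≠ 0 := by linarith
    refine ⟨(c - b) / (c - a), (b - a) / (c - a), div_pos (by linarith) (by linarith),
      div_pos (by linarith) (by linarith), ?_, ?_⟩
    · field_simp; ring
    · field_simp; ring
  have h1 := strictConcaveOn_log_Ioi.2 ha (ha.trans hac) hac.ne hs ht hst
  have h2 := strictConcaveOn_log_Ioi.concaveOn.2 haq hc hs.le ht.le hst
  simp only [smul_eq_mul] at h1 h2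
  have h3 : s * (1 / 2 - a / q) + t * (1 / 2 - c / q) = 1 / 2 - b / q := by
    rw [← hsum]
    linear_combination (1 / 2) * hst
  rw [hsum] at h1
  rw [h3] at h2
  have h4 := mul_lt_mul_of_pos_left h1 hθ
  have key : s * Real.log (depthProfile q a) + t * Real.log (depthProfile q c) <
      Real.log (depthProfile q b) := by
    rw [hlog ha haq, hlog hb hbq, hlog (ha.trans hac) hc]
    linarith
  by_contra! hle
  have pb := depthProfile_pos hb hbq
  have la := Real.log_le_log pb (hle.trans (min_le_left _ _))
  have lc := Real.log_le_log pb (hle.trans (min_le_right _ _))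
  have ma := mul_le_mul_of_nonneg_left la hs.le
  have mc := mul_le_mul_of_nonneg_left lc ht.le
  have : Real.log (depthProfile q b) =
      s * Real.log (depthProfile q b) + t * Real.log (depthProfile q b) := by
    rw [← add_mul, hst, one_mul]
  linarith

variable {N : ℕ} [hN : Fact (3 ≤ N)] {μ : ℝ}

theorem A_pos (hμ : μ ≤ ((N : ℝ) - 2) ^ 2 / 8) {v : X N} (hv : ‖v.grad‖ ≠ 0) : 0 < A μ v := by
  have hN' : (3 : ℝ) ≤ N := by exact_mod_cast hN.out
  have h := norm_sq_div_le_A hμ v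
  rw [norm_eq_norm_grad hN.out] at h
  have : 0 < ‖v.grad‖ ^ 2 / N := by positivity
  linarith

omit hN in
theorem E_eq_of_mem_nehariδ {δ : ℝ} {v : X N} (hv : v ∈ nehariδ N μ δ) :
    E μ v = (1 / 2 - δ / critExp N) * A μ v := by
  have h : δ * A μ v - B v = 0 := hv.1
  have hB : B v = δ * A μ v := by linarith
  rw [E, hB]
  ring

omit hN in
theorem depthδ_le {δ : ℝ} {v : X N} (hv : v ∈ nehariδ N μ δ) :
    depthδ N μ δ ≤ ((E μ v : ℝ) : EReal) := iInf₂_le v hv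

omit hN in
theorem norm_grad_smul_ne_zero {t : ℝ} (ht : 0 < t) {v : X N} (hv : ‖v.grad‖ ≠ 0) :
    ‖(t • v).grad‖ ≠ 0 := by
  rw [← gradL_apply, map_smul, norm_smul]
  exact mul_ne_zero (by simp [ht.ne']) hv

theorem smul_mem_nehariδ {δ δ' : ℝ} (hδ : 0 < δ) (hδ' : 0 < δ') {v : X N}
    (hv : v ∈ nehariδ N μ δ) :
    (δ' / δ) ^ (1 / (critExp N - 2)) • v ∈ nehariδ N μ δ' := by
  have hq := two_lt_critExp hN.out
  have hpos : 0 < δ' / δ := div_pos hδ' hδ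
  set t := (δ' / δ) ^ (1 / (critExp N - 2)) with ht
  have htpos : 0 < t := Real.rpow_pos_of_pos hpos _
  refine ⟨?_, norm_grad_smul_ne_zero htpos hv.2⟩
  have h : δ * A μ v - B v = 0 := hv.1
  have htq : t ^ critExp N = t ^ 2 * (δ' / δ) := by
    have h1 : t ^ (critExp N - 2) = δ' / δ := by
      rw [ht, ← Real.rpow_mul hpos.le, one_div_mul_cancel (by linarith), Real.rpow_one]
    rw [← h1, ← Real.rpow_two, ← Real.rpow_add htpos]
    congr 1
    ring
  change δ' * A μ (t • v) - B (t • v) = 0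
  rw [A_smul, B_smul htpos.le, htq, show B v = δ * A μ v by linarith]
  field_simp
  ring

/-- Scaling by a power of `δ' / δ` maps one Nehari set into the other and multiplies `A` by a fixed
factor, so the energies change by the ratio of the profiles. -/
theorem depthδ_scaling {δ δ' c : ℝ} (hδ : 0 < δ) (hδq : 0 < 1 / 2 - δ / critExp N) (hδ' : 0 < δ')
    (hδ'q : 0 < 1 / 2 - δ' / critExp N) (hc : (c : EReal) ≤ depthδ N μ δ) :
    ((c * (depthProfile (critExp N) δ' / depthProfile (critExp N) δ) : ℝ) : EReal) ≤
      depthδ N μ δ' := by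
  refine le_iInf₂ fun v hv => ?_
  have hv' := smul_mem_nehariδ hδ' hδ hv
  have hpos : 0 < δ / δ' := div_pos hδ hδ'
  have h := hc.trans (depthδ_le hv')
  rw [EReal.coe_le_coe_iff] at h ⊢
  rw [E_eq_of_mem_nehariδ hv', A_smul, ← Real.rpow_two, ← Real.rpow_mul hpos.le,
    Real.div_rpow hδ.le hδ'.le] at h
  rw [E_eq_of_mem_nehariδ hv, ← mul_div_assoc, div_le_iff₀ (depthProfile_pos hδ hδq)]
  unfold depthProfile
  rw [one_div_mul_eq_div] at h
  have hp := Real.rpow_pos_of_pos hδ (2 / (critExp N - 2))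
  have hp' := Real.rpow_pos_of_pos hδ' (2 / (critExp N - 2))
  have h2 := mul_le_mul_of_nonneg_right h (mul_pos hδ'q hp').le
  refine h2.trans (le_of_eq ?_)
  field_simp

/-- A finite depth means the Nehari set is nonempty, and there `E` is `1/2 - δ/2^*` times `A > 0`. A
negative `δ` contradicts `B ≥ 0`; for `δ = 0` the set is invariant under scaling, so energies would
not stay above `e`. -/
theorem pos_of_depthδ_eq (hμ : μ ≤ ((N : ℝ) - 2) ^ 2 / 8) {δ e : ℝ} (he : 0 < e)
    (h : depthδ N μ δ = (e : EReal)) : 0 < δ ∧ 0 < 1 / 2 - δ / critExp N := by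
  have hq := two_lt_critExp hN.out
  obtain ⟨v, hv⟩ : (nehariδ N μ δ).Nonempty := by
    by_contra! hne
    rw [depthδ, hne] at h
    simp at h
  have hA := A_pos hμ hv.2
  have hle {u : X N} (hu : u ∈ nehariδ N μ δ) : e ≤ (1 / 2 - δ / critExp N) * A μ u := by
    have := depthδ_le hu
    rw [h, EReal.coe_le_coe_iff, E_eq_of_mem_nehariδ hu] at this
    exact this
  refine ⟨?_, pos_of_mul_pos_left (he.trans_le (hle hv)) hA.le⟩
  by_contra! hδ
  have hD : δ * A μ v - B v = 0 := hv.1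
  have hB := B_nonneg v
  have hδ0 : δ = 0 := by
    have : 0 ≤ δ := by
      by_contra! hlt
      nlinarith
    linarith
  subst hδ0
  have hB0 : B v = 0 := by linarith
  -- This makes `A(t v) = e`, hence `E(t v) = e/2 < e`.
  set t := √(e / A μ v) with ht
  have htpos : 0 < t := Real.sqrt_pos.2 (div_pos he hA)
  have htv : t • v ∈ nehariδ N μ 0 := by
    refine ⟨?_, norm_grad_smul_ne_zero htpos hv.2⟩
    change 0 * A μ (t • v) - B (t • v) = 0
    rw [B_smul htpos.le, hB0]
    ring
  have h2 := hle htv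
  rw [A_smul, ht, Real.sq_sqrt (by positivity), div_mul_cancel₀ _ hA.ne'] at h2
  simp at h2
  linarith

theorem depth_eq_depthδ_one : depth N μ = depthδ N μ 1 := by
  have : nehari N μ = nehariδ N μ 1 := by
    ext v
    simp only [nehari, nehariδ, D, Dδ, one_mul, mem_ofPred_eq, ← norm_eq_norm_grad hN.out,
      ne_eq, norm_eq_zero]
  rw [depth, depthδ, this]

section Roots

variable {e δ₁ δ₂ : ℝ}

/-- The profile at `δ` exceeds its value at one of the two roots; scaling from that root multiplies
`e` by a factor above `1`. -/
theorem lt_depthδ_of_mem_Ioo (hμ : μ ≤ ((N : ℝ) - 2) ^ 2 / 8) (he : 0 < e)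
    (hδ₁ : depthδ N μ δ₁ = (e : EReal)) (hδ₂ : depthδ N μ δ₂ = (e : EReal)) {δ : ℝ}
    (hδ : δ ∈ Ioo δ₁ δ₂) : (e : EReal) < depthδ N μ δ := by
  have hq := two_lt_critExp hN.out
  obtain ⟨h1, h1q⟩ := pos_of_depthδ_eq hμ he hδ₁
  obtain ⟨h2, h2q⟩ := pos_of_depthδ_eq hμ he hδ₂
  have hpos : 0 < δ := h1.trans hδ.1
  have hposq : 0 < 1 / 2 - δ / critExp N := by
    have : δ / critExp N < δ₂ / critExp N := by
      gcongr
      exact hδ.2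
    linarith
  have key {x : ℝ} (hx : 0 < x) (hxq : 0 < 1 / 2 - x / critExp N)
      (hxe : depthδ N μ x = (e : EReal))
      (hlt : depthProfile (critExp N) x < depthProfile (critExp N) δ) :
      (e : EReal) < depthδ N μ δ := by
    refine lt_of_lt_of_le ?_ (depthδ_scaling hx hxq hpos hposq hxe.ge)
    rw [EReal.coe_lt_coe_iff]
    have : 1 < depthProfile (critExp N) δ / depthProfile (critExp N) x := by
      rwa [one_lt_div (depthProfile_pos hx hxq)]
    nlinarith
  rcases min_lt_iff.1 (min_lt_depthProfile hq h1 hδ.1 hδ.2 h2q) with h | h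
  · exact key h1 h1q hδ₁ h
  · exact key h2 h2q hδ₂ h

/-- The profile is equal at the two roots and larger at `1`. Were `1` outside the interval, the
nearer root would violate `min_lt_depthProfile`, or coincide with `1`. -/
theorem one_mem_Ioo (hμ : μ ≤ ((N : ℝ) - 2) ^ 2 / 8) (he : 0 < e)
    (hed : (e : EReal) < depth N μ) (hδ : δ₁ < δ₂)
    (hδ₁ : depthδ N μ δ₁ = (e : EReal)) (hδ₂ : depthδ N μ δ₂ = (e : EReal)) :
    (1 : ℝ) ∈ Ioo δ₁ δ₂ := by
  have hq := two_lt_critExp hN.out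
  obtain ⟨h1, h1q⟩ := pos_of_depthδ_eq hμ he hδ₁
  obtain ⟨h2, h2q⟩ := pos_of_depthδ_eq hμ he hδ₂
  have h0q : 0 < 1 / 2 - 1 / critExp N := by
    have : 1 / critExp N < 1 / 2 := by gcongr
    linarith
  obtain ⟨c, hec, hcd⟩ := EReal.lt_iff_exists_real_btwn.1 hed
  rw [EReal.coe_lt_coe_iff] at hec
  rw [depth_eq_depthδ_one] at hcd
  have hle {x y c : ℝ} (hx : 0 < x) (hxq : 0 < 1 / 2 - x / critExp N) (hy : 0 < y)
      (hyq : 0 < 1 / 2 - y / critExp N) (hxe : (c : EReal) ≤ depthδ N μ x)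
      (hye : depthδ N μ y = (e : EReal)) :
      c * depthProfile (critExp N) y ≤ e * depthProfile (critExp N) x := by
    have := depthδ_scaling hx hxq hy hyq hxe
    rwa [hye, EReal.coe_le_coe_iff, ← mul_div_assoc, div_le_iff₀ (depthProfile_pos hx hxq)] at this
  have heq : depthProfile (critExp N) δ₁ = depthProfile (critExp N) δ₂ :=
    le_antisymm (le_of_mul_le_mul_left (hle h2 h2q h1 h1q hδ₂.ge hδ₁) he)
      (le_of_mul_le_mul_left (hle h1 h1q h2 h2q hδ₁.ge hδ₂) he)
  have hlt : depthProfile (critExp N) δ₁ < depthProfile (critExp N) 1 := by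
    have h := hle one_pos h0q h1 h1q hcd.le hδ₁
    have hp := depthProfile_pos h1 h1q
    nlinarith
  constructor
  · by_contra! h
    rcases eq_or_lt_of_le h with h | h
    · rw [← h] at hlt; exact lt_irrefl _ hlt
    · have := min_lt_depthProfile hq one_pos h hδ h2q
      rw [min_eq_right (by rw [← heq]; exact hlt.le), heq] at this
      exact lt_irrefl _ this
  · by_contra! h
    rcases eq_or_lt_of_le h with h | h
    · rw [heq, h] at hlt; exact lt_irrefl _ hlt
    · have := min_lt_depthProfile hq h1 hδ h h0q
      rw [min_eq_left hlt.le, heq] at this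
      exact lt_irrefl _ this

end Roots

/-- `B` is of order `‖v‖^{2^*}` with `2^* > 2`, while `δ A` is at least `δ ‖v‖² / N`. -/
theorem exists_Dδ_nonneg_near_zero (hμ : μ ≤ ((N : ℝ) - 2) ^ 2 / 8) {δ : ℝ} (hδ : 0 < δ) :
    ∃ ρ > 0, ∀ v : X N, ‖v‖ < ρ → 0 ≤ Dδ μ δ v := by
  have hq := two_lt_critExp hN.out
  have hN' : (3 : ℝ) ≤ N := by exact_mod_cast hN.out
  have hcont : Continuous (fun ρ : ℝ => ‖critL N‖ ^ critExp N * ρ ^ (critExp N - 2)) :=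
    continuous_const.mul (continuous_id.rpow_const fun _ => Or.inr (by linarith))
  have hlim := (hcont.tendsto 0).mono_left (nhdsWithin_le_nhds (s := Ioi 0))
  rw [Real.zero_rpow (by linarith), mul_zero] at hlim
  obtain ⟨ρ, h1, h2⟩ := ((hlim.eventually_lt_const (by positivity : 0 < δ / N)).and
    self_mem_nhdsWithin).exists
  refine ⟨ρ, h2, fun v hv => ?_⟩
  have hB := B_le v
  have hA := mul_le_mul_of_nonneg_left (norm_sq_div_le_A hμ v) hδ.le
  have hsplit : ‖v‖ ^ critExp N = ‖v‖ ^ (critExp N - 2) * ‖v‖ ^ 2 := by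
    rw [← Real.rpow_two, ← Real.rpow_add' (norm_nonneg v) (by linarith), sub_add_cancel]
  have h3 : ‖critL N‖ ^ critExp N * ‖v‖ ^ (critExp N - 2) ≤ δ / N := by
    refine le_trans ?_ h1.le
    gcongr
  have h4 := mul_le_mul_of_nonneg_right h3 (sq_nonneg ‖v‖)
  rw [hsplit, ← mul_assoc] at hB
  have h5 : δ / N * ‖v‖ ^ 2 = δ * (‖v‖ ^ 2 / N) := by ring
  rw [Dδ]
  linarith

theorem eq_zero_of_Dδ_eq_zero {δ e : ℝ} (hlt : (e : EReal) < depthδ N μ δ) {v : X N}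
    (hE : E μ v ≤ e) (hD : Dδ μ δ v = 0) : v = 0 := by
  by_contra hne
  have hmem : v ∈ nehariδ N μ δ := by
    refine ⟨hD, ?_⟩
    rw [← norm_eq_norm_grad hN.out]
    simpa using hne
  exact absurd ((depthδ_le hmem).trans (by exact_mod_cast hE)) (not_le.2 hlt)

/-- The sign is locally constant by continuity where `D_{K,δ} ≠ 0`. Where it vanishes the state is
zero, and nearby states satisfy `D_{K,δ} ≥ 0`. Connectedness of the time interval concludes. -/
theorem Dδ_nonneg_iff_along {δ e s : ℝ} (hμ : μ ≤ ((N : ℝ) - 2) ^ 2 / 8) (hδ : 0 < δ)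
    (hlt : (e : EReal) < depthδ N μ δ) {v : ℝ → X N} (hv : ContinuousOn v (Icc 0 s)) (hs : 0 ≤ s)
    (hE : ∀ t ∈ Icc 0 s, E μ (v t) ≤ e) :
    0 ≤ Dδ μ δ (v 0) ↔ 0 ≤ Dδ μ δ (v s) := by
  obtain ⟨ρ, hρ, hnear⟩ := exists_Dδ_nonneg_near_zero hμ hδ
  have hf : ContinuousOn (fun t => Dδ μ δ (v t)) (Icc 0 s) :=
    (continuous_Dδ μ δ).comp_continuousOn hv
  refine isPreconnected_Icc.induction₂
    (fun x y => 0 ≤ Dδ μ δ (v x) ↔ 0 ≤ Dδ μ δ (v y)) ?_ (fun x y z _ _ _ => Iff.trans)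
    (fun x y _ _ => Iff.symm) (left_mem_Icc.2 hs) (right_mem_Icc.2 hs)
  intro t ht
  rcases lt_trichotomy (Dδ μ δ (v t)) 0 with h | h | h
  · filter_upwards [(hf t ht).eventually_lt_const h] with x hx
    exact iff_of_false (not_le.2 h) (not_le.2 hx)
  · have hzero := eq_zero_of_Dδ_eq_zero hlt (hE t ht) h
    have hn := (hv t ht).norm
    rw [ContinuousWithinAt, hzero, norm_zero] at hn
    filter_upwards [hn.eventually_lt_const hρ] with x hx
    exact iff_of_true h.ge (hnear _ hx)
  · filter_upwards [(hf t ht).eventually_const_lt h] with x hx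
    exact iff_of_true h.le hx.le

theorem Dδ_ne_zero_of_energy_eq {δ e : ℝ} (he : 0 < e) (hlt : (e : EReal) < depthδ N μ δ)
    {v : X N} (hE : E μ v = e) : Dδ μ δ v ≠ 0 := by
  have hq := two_lt_critExp hN.out
  intro h
  have h0 := eq_zero_of_Dδ_eq_zero hlt hE.le h
  have hA : A μ (0 : X N) = 0 := by simpa using A_smul μ 0 (0 : X N)
  have hB : B (0 : X N) = 0 := by
    rw [B_eq, map_zero, norm_zero, Real.zero_rpow (by linarith)]
  rw [h0, E, hA, hB] at hE
  simp at hE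
  linarith

omit hN in
/-- `D_{K,δ}(v)` is affine in `δ`, so it keeps its sign on an interval where it has no zero. -/
theorem Dδ_pos_iff {δ₁ δ₂ δ : ℝ} {v : X N} (hne : ∀ δ ∈ Ioo δ₁ δ₂, Dδ μ δ v ≠ 0)
    (h1 : (1 : ℝ) ∈ Ioo δ₁ δ₂) (hδ : δ ∈ Ioo δ₁ δ₂) : 0 < D μ v ↔ 0 < Dδ μ δ v := by
  have hD : D μ v = Dδ μ 1 v := by rw [D, Dδ, one_mul]
  have hcont : ContinuousOn (fun δ => Dδ μ δ v) (Ioo δ₁ δ₂) := by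
    unfold Dδ
    fun_prop
  rw [hD]
  have hivt {x y : ℝ} (hx : x ∈ Ioo δ₁ δ₂) (hy : y ∈ Ioo δ₁ δ₂) (hpos : 0 < Dδ μ x v) :
      0 < Dδ μ y v := by
    by_contra! hle
    obtain ⟨z, hz, hz0⟩ := isPreconnected_Ioo.intermediate_value hy hx hcont ⟨hle, hpos.le⟩
    exact hne z hz hz0
  exact ⟨hivt h1 hδ, hivt hδ h1⟩

end Wells

end HardySobolev
end

/-! ### Invariance of the wells -/

theorem theorem3p1 (N : ℕ) (hN : 3 ≤ N) (μ : ℝ) (hμ₀ : 0 ≤ μ) (hμ : μ ≤ ((N : ℝ) - 2) ^ 2 / 8)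
    (v₀ : HardySobolev.X N) (e : ℝ) (he : 0 < e)
    (hed : (e : EReal) < HardySobolev.depth N μ)
    (δ₁ δ₂ : ℝ) (hδ : δ₁ < δ₂)
    (hδ₁ : HardySobolev.depthδ N μ δ₁ = (e : EReal))
    (hδ₂ : HardySobolev.depthδ N μ δ₂ = (e : EReal))
    (hE : HardySobolev.E μ v₀ = e) :
    (0 < HardySobolev.D μ v₀ →
      ∀ (S : EReal) (v : ℝ → HardySobolev.X N), HardySobolev.IsWeakSolutionUpTo μ v₀ v S →
        ∀ δ ∈ Set.Ioo δ₁ δ₂, ∀ s : ℝ, 0 ≤ s → (s : EReal) < S →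
          v s ∈ HardySobolev.W N μ δ) ∧
    (HardySobolev.D μ v₀ < 0 →
      ∀ (S : EReal) (v : ℝ → HardySobolev.X N), HardySobolev.IsWeakSolutionUpTo μ v₀ v S →
        ∀ δ ∈ Set.Ioo δ₁ δ₂, ∀ s : ℝ, 0 ≤ s → (s : EReal) < S →
          v s ∈ HardySobolev.V N μ δ) := by
  open HardySobolev in
  have : Fact (3 ≤ N) := ⟨hN⟩
  have hwell {δ : ℝ} (h : δ ∈ Ioo δ₁ δ₂) : (e : EReal) < depthδ N μ δ :=
    lt_depthδ_of_mem_Ioo hμ he hδ₁ hδ₂ h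
  have hone : (1 : ℝ) ∈ Ioo δ₁ δ₂ := one_mem_Ioo hμ he hed hδ hδ₁ hδ₂
  have hne : ∀ δ ∈ Ioo δ₁ δ₂, Dδ μ δ v₀ ≠ 0 := fun δ h =>
    Dδ_ne_zero_of_energy_eq he (hwell h) hE
  have hflow {S : EReal} {v : ℝ → X N} (hv : IsWeakSolutionUpTo μ v₀ v S) {δ : ℝ}
      (h : δ ∈ Ioo δ₁ δ₂) {s : ℝ} (hs : 0 ≤ s) (hsS : (s : EReal) < S) :
      E μ (v s) ≤ e ∧ (0 ≤ Dδ μ δ v₀ ↔ 0 ≤ Dδ μ δ (v s)) := by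
    have hsub : Icc 0 s ⊆ {t : ℝ | 0 ≤ t ∧ (t : EReal) < S} := fun t ht =>
      ⟨ht.1, lt_of_le_of_lt (by exact_mod_cast ht.2) hsS⟩
    have hle : ∀ t ∈ Icc 0 s, E μ (v t) ≤ e := fun t ht => by
      rw [← hE]
      exact hv.energy_le hμ (hsub ht).1 (hsub ht).2
    have hinit : v 0 = v₀ := by
      obtain ⟨T, hsT, hTS⟩ := EReal.lt_iff_exists_real_btwn.1 hsS
      exact (hv.weak T (hs.trans_lt (by exact_mod_cast hsT)) hTS).initial
    refine ⟨hle s (right_mem_Icc.2 hs), ?_⟩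
    rw [← hinit]
    exact Dδ_nonneg_iff_along hμ ((pos_of_depthδ_eq hμ he hδ₁).1.trans h.1) (hwell h)
      (hv.continuousOn_X.mono hsub) hs hle
  constructor
  · intro hD S v hv δ h s hs hsS
    obtain ⟨hEs, hiff⟩ := hflow hv h hs hsS
    have hpos := (Dδ_pos_iff hne hone h).1 hD
    -- The flow preserves only the weak inequality: the solution may reach zero, and this is why
    -- `W_δ` includes the origin.
    rcases eq_or_lt_of_le (hiff.1 hpos.le) with h0 | h0
    · exact Or.inr (eq_zero_of_Dδ_eq_zero (hwell h) hEs h0.symm)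
    · exact Or.inl ⟨h0, lt_of_le_of_lt (by exact_mod_cast hEs) (hwell h)⟩
  · intro hD S v hv δ h s hs hsS
    obtain ⟨hEs, hiff⟩ := hflow hv h hs hsS
    have hneg : Dδ μ δ v₀ < 0 := by
      refine lt_of_le_of_ne ?_ (hne δ h)
      by_contra! hpos
      exact absurd ((Dδ_pos_iff hne hone h).2 hpos) (not_lt.2 hD.le)
    refine ⟨?_, lt_of_le_of_lt (by exact_mod_cast hEs) (hwell h)⟩
    by_contra! hpos
    exact absurd (hiff.2 hpos) (not_le.2 hneg)
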